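/- Let $\alpha\in\mathbb R$, let $\sigma\in\mathbb C$ be a constant and let $p\ge 1$ be an integer. For $\alpha>0$ let $$I_s^{\alpha}f(x)=\frac1{\Gamma(\alpha)}\int_0^x (x-\tau)^{\alpha-1}e^{-\sigma(x-\tau)}f(\tau)\,d\tau$$ be the fractional substantial integral, and for $\alpha\le 0$ let $I_s^{\alpha}f=\left(\frac{d}{dx}+\sigma\right)^m I_s^{m+\alpha}f$, with $m$ the smallest integer exceeding $-\alpha$, be the fractional substantial derivative of order $-\alpha$; where the integral diverges at $\tau=0$ it is understood as Hadamard's finite part. Let $\omega=(\omega_n)_{n\ge0}$ be a complex sequence whose generating power series has, in the part of the unit disc near $\zeta=1$, the form $$\omega(\zeta)=\sum_{n=0}^\infty\omega_n\zeta^n=(1-\zeta)^{-\alpha}\,\widetilde\omega(\zeta)$$ with $\widetilde\omega$ holomorphic in a neighbourhood of $\zeta=1$. For a step size $h>0$ put $\kappa_j=e^{-j\sigma h}\omega_j$, $\kappa(\zeta)=\sum_{n\ge 0}\kappa_n\zeta^n$, and, at $x=nh$, $$\left(E_{s,h}^{\alpha}f\right)(x)=h^\alpha\sum_{j=0}^n\kappa_{n-j}f(jh)-I_s^\alpha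 f(x).$$ The convolution quadrature $\kappa$ is called * stable if $\kappa_n=\mathcal O(n^{\alpha-1})$ for $n\ge1$, uniformly for $nh$ in bounded sets; * consistent of order $p$ if $h^\alpha\kappa(e^{\sigma h}e^{-h})=1+\mathcal O(h^p)$ as $h\to0^+$; * convergent of order $p$ if for every $\beta\in\mathbb C\setminus\{0,-1,-2,\dots\}$ one has $\left(E_{s,h}^{\alpha}[e^{-\sigma t}t^{\beta-1}]\right)(1)=\mathcal O(h^{\beta})+\mathcal O(h^p)$, where $h=1/n$, $n\to\infty$ (at $t=0$ the function $t^{\beta-1}$ is given the value $1$ if $\beta=1$ and $0$ otherwise). Then $\kappa$ is stable and consistent of order $p$ if and only if it is convergent of order $p$. -/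

import Mathlib

noncomputable section

open Filter Topology

/-- `c` is the Hadamard finite part of `F(ε)` as `ε → 0⁺`: after finitely many terms
`a ε ^ l` with `l ≠ 0` are subtracted from `F(ε)`, the rest tends to `c`. -/
def HasFinitePart (F : ℝ → ℂ) (c : ℂ) : Prop :=
  ∃ (k : ℕ) (a l : Fin k → ℂ), (∀ i, l i ≠ 0) ∧
    Tendsto (fun ε : ℝ => F ε - ∑ i, a i * (ε : ℂ) ^ l i) (𝓝[>] 0) (𝓝 c)

theorem finitePart_aux (k : ℕ) : ∀ (a l : Fin k → ℂ) (c : ℂ), (∀ i, l i ≠ 0) →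
    Tendsto (fun ε : ℝ => ∑ i, a i * (ε : ℂ) ^ l i) (𝓝[>] 0) (𝓝 c) → c = 0 := by
  induction k with
  | zero =>
    intro a l c _ h
    simp only [Finset.univ_eq_empty, Finset.sum_empty] at h
    exact (tendsto_nhds_unique h tendsto_const_nhds)
  | succ k ih =>
    intro a l c hl h
    -- a scale `q > 0` with `q ^ l₀ ≠ 1`
    obtain ⟨q, hq, hq1⟩ : ∃ q : ℝ, 0 < q ∧ (q : ℂ) ^ l 0 ≠ 1 := by
      refine ⟨Real.exp (1 / ‖l 0‖), Real.exp_pos _, ?_⟩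
      intro h1
      have hn : 0 < ‖l 0‖ := norm_pos_iff.2 (hl 0)
      have h2 : Complex.exp ((1 / ‖l 0‖ : ℝ) * l 0) = 1 := by
        rw [← h1, Complex.cpow_def_of_ne_zero (by
          exact_mod_cast (Real.exp_pos _).ne'), ← Complex.ofReal_log (Real.exp_pos _).le,
          Real.log_exp]
      obtain ⟨m, hm⟩ := Complex.exp_eq_one_iff.1 h2
      have h3 : ‖((1 / ‖l 0‖ : ℝ) : ℂ) * l 0‖ = 1 := by
        rw [norm_mul, Complex.norm_real, Real.norm_of_nonneg (by positivity)]
        field_simp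
      rw [hm] at h3
      have hpi : (3 : ℝ) < Real.pi := Real.pi_gt_three
      have h4 : |(m : ℝ)| * (2 * Real.pi) = 1 := by
        simpa [abs_of_pos Real.pi_pos] using h3
      rcases eq_or_ne m 0 with hm0 | hm0
      · simp [hm0] at h4
      · have : (1 : ℝ) ≤ |(m : ℝ)| := by exact_mod_cast Int.one_le_abs hm0
        nlinarith
    have hs : Tendsto (fun ε : ℝ => q * ε) (𝓝[>] 0) (𝓝[>] 0) := by
      refine tendsto_nhdsWithin_iff.2 ⟨?_, ?_⟩
      · have : Tendsto (fun ε : ℝ => q * ε) (𝓝 0) (𝓝 (q * 0)) :=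
          (continuous_const.mul continuous_id).tendsto 0
        rw [mul_zero] at this
        exact this.mono_left nhdsWithin_le_nhds
      · filter_upwards [self_mem_nhdsWithin] with ε hε
        exact mul_pos hq hε
    have h' := (h.comp hs).sub (h.const_mul ((q : ℂ) ^ l 0))
    have key := ih (fun i => a i.succ * ((q : ℂ) ^ l i.succ - (q : ℂ) ^ l 0))
      (fun i => l i.succ) (c - (q : ℂ) ^ l 0 * c) (fun i => hl _) (by
        refine h'.congr' ?_
        filter_upwards [self_mem_nhdsWithin] with ε hε
        have hm : ∀ z : ℂ, ((q * ε : ℝ) : ℂ) ^ z = (q : ℂ) ^ z * (ε : ℂ) ^ z := fun z => by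
          rw [Complex.ofReal_mul]
          exact Complex.mul_cpow_ofReal_nonneg hq.le (le_of_lt hε) z
        simp only [Function.comp, hm, Fin.sum_univ_succ, mul_add, Finset.mul_sum]
        rw [add_sub_add_comm, ← Finset.sum_sub_distrib]
        have : a 0 * ((q : ℂ) ^ l 0 * (ε : ℂ) ^ l 0) - (q : ℂ) ^ l 0 * (a 0 * (ε : ℂ) ^ l 0) = 0 := by
          ring
        rw [this, zero_add]
        exact Finset.sum_congr rfl fun i _ => by ring)
    have : (1 - (q : ℂ) ^ l 0) * c = 0 := by rw [← key]; ring
    exact (mul_eq_zero.1 this).resolve_left (sub_ne_zero.2 (Ne.symm hq1))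

/-- The finite part is unique. -/
theorem HasFinitePart.unique {F : ℝ → ℂ} {c d : ℂ} (hc : HasFinitePart F c)
    (hd : HasFinitePart F d) : c = d := by
  obtain ⟨k, a, l, hl, h⟩ := hc
  obtain ⟨k', a', l', hl', h'⟩ := hd
  have := finitePart_aux (k' + k) (Fin.append a' (fun i => - a i)) (Fin.append l' l) (c - d)
    (fun i => by
      refine Fin.addCases (fun j => ?_) (fun j => ?_) i
      · rw [Fin.append_left]; exact hl' j
      · rw [Fin.append_right]; exact hl j)
    ((h.sub h').congr fun ε => by
      simp only [Fin.sum_univ_add, Fin.append_left, Fin.append_right, neg_mul,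
        Finset.sum_neg_distrib]
      ring)
  exact sub_eq_zero.1 this

open Classical in
/-- The Hadamard finite part of `F(ε)` as `ε → 0⁺` (and `0` if there is none). -/
def finitePart (F : ℝ → ℂ) : ℂ :=
  if h : ∃ c, HasFinitePart F c then h.choose else 0

theorem HasFinitePart.finitePart_eq {F : ℝ → ℂ} {c : ℂ} (h : HasFinitePart F c) :
    finitePart F = c := by
  have h' : ∃ c, HasFinitePart F c := ⟨c, h⟩
  rw [finitePart, dif_pos h']
  exact h'.choose_spec.unique h

/-- If `F(ε)` converges as `ε → 0⁺`, then its finite part is the limit. -/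
theorem finitePart_eq_of_tendsto {F : ℝ → ℂ} {c : ℂ} (h : Tendsto F (𝓝[>] 0) (𝓝 c)) :
    finitePart F = c :=
  HasFinitePart.finitePart_eq ⟨0, Fin.elim0, Fin.elim0, fun i => i.elim0, by simpa using h⟩

/-- The fractional substantial integral of order `ν > 0` with lower terminal `0`,
`(1 / Γ(ν)) ∫_0^x (x - τ)^(ν-1) e^(-σ (x - τ)) f(τ) dτ`.
The integral at the end point `0` is a limit of integrals over `[ε, x]`, and the finite part of
these where they diverge, so that `f(τ) = e^(-σ τ) τ^(β-1)` with `Re β ≤ 0` is allowed. -/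
def substantialIntegral (σ : ℂ) (ν : ℝ) (f : ℝ → ℂ) (x : ℝ) : ℂ :=
  (1 / (Real.Gamma ν : ℂ)) *
    finitePart fun ε => ∫ τ in ε..x,
      (((x - τ) ^ (ν - 1) : ℝ) : ℂ) * Complex.exp (-σ * ((x - τ : ℝ) : ℂ)) * f τ

/-- The operator `D_s = d/dx + σ`. -/
def substantialD (σ : ℂ) (g : ℝ → ℂ) (x : ℝ) : ℂ := deriv g x + σ * g x

/-- The fractional substantial derivative of order `μ ≥ 0`: `D_s^m I_s^(m-μ) f`, where `m` is the
smallest integer that exceeds `μ`. -/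
def substantialDerivative (σ : ℂ) (μ : ℝ) (f : ℝ → ℂ) : ℝ → ℂ :=
  (substantialD σ)^[⌊μ⌋₊ + 1] (substantialIntegral σ ((⌊μ⌋₊ + 1 : ℕ) - μ) f)

/-- `I_s^α` for real `α`: the integral of order `α` if `α > 0`, the derivative of order `-α`
otherwise. -/
def substantialI (σ : ℂ) (α : ℝ) (f : ℝ → ℂ) : ℝ → ℂ :=
  if 0 < α then substantialIntegral σ α f else substantialDerivative σ (-α) f

/-- The weights `κ_j = e^(-j σ h) ω_j`; they depend on the step size `h`. -/
def weightedCQ (σ : ℂ) (ω : ℕ → ℂ) (h : ℝ) (j : ℕ) : ℂ :=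
  Complex.exp (-(j : ℂ) * σ * (h : ℂ)) * ω j

/-- The convolution quadrature `h^α ∑_{j=0}^n κ_{n-j} f(j h)` at the point `x = n h`. -/
def convQuad (α : ℝ) (κ : ℝ → ℕ → ℂ) (h : ℝ) (n : ℕ) (f : ℝ → ℂ) : ℂ :=
  ((h ^ α : ℝ) : ℂ) * ∑ j ∈ Finset.range (n + 1), κ h (n - j) * f (j * h)

/-- The convolution quadrature error at the point `x = n h`. -/
def convQuadError (σ : ℂ) (α : ℝ) (κ : ℝ → ℕ → ℂ) (h : ℝ) (n : ℕ) (f : ℝ → ℂ) : ℂ :=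
  convQuad α κ h n f - substantialI σ α f (n * h)

/-- Stability: `κ_n = O(n^(α-1))`, uniformly for `x = n h` in bounded sets. -/
def CQStable (α : ℝ) (κ : ℝ → ℕ → ℂ) : Prop :=
  ∀ X : ℝ, 0 < X → ∃ C : ℝ, ∀ (h : ℝ) (n : ℕ), 0 < h → 1 ≤ n → n * h ≤ X →
    ‖κ h n‖ ≤ C * (n : ℝ) ^ (α - 1)

/-- Consistency of order `p`: `h^α κ(e^(σ h) e^(-h)) = 1 + O(h^p)` as `h → 0⁺`, with the generating
power series `κ(ζ) = ∑ κ_n ζ^n`. -/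
def CQConsistent (σ : ℂ) (α : ℝ) (p : ℕ) (κ : ℝ → ℕ → ℂ) : Prop :=
  (∀ᶠ h : ℝ in 𝓝[>] 0,
    Summable fun n : ℕ => κ h n * (Complex.exp (σ * h) * Complex.exp (-(h : ℂ))) ^ n) ∧
  (fun h : ℝ => ((h ^ α : ℝ) : ℂ) *
      (∑' n : ℕ, κ h n * (Complex.exp (σ * h) * Complex.exp (-(h : ℂ))) ^ n) - 1)
    =O[𝓝[>] 0] fun h : ℝ => h ^ p

/-- Convergence of order `p`: for every complex `β` other than `0, -1, -2, …`, the error for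
`e^(-σ t) t^(β-1)` at `x = n h = 1` is `O(h^β) + O(h^p)`. (At `t = 0` the power `t^(β-1)` has the
value `1` if `β = 1` and `0` otherwise.) -/
def CQConvergent (σ : ℂ) (α : ℝ) (p : ℕ) (κ : ℝ → ℕ → ℂ) : Prop :=
  ∀ β : ℂ, (∀ k : ℕ, β ≠ -(k : ℂ)) →
    ∃ C : ℝ, ∀ (h : ℝ) (n : ℕ), 0 < h → n * h = 1 →
      ‖convQuadError σ α κ h n
          (fun t : ℝ => Complex.exp (-σ * (t : ℂ)) * (t : ℂ) ^ (β - 1))‖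
        ≤ C * (h ^ β.re + h ^ p)

/-- The generating power series is `ω(ζ) = (1 - ζ)^(-α) g(ζ)` in the unit disc near `ζ = 1`, where
`g` is holomorphic at `1`. -/
def CQRegular (α : ℝ) (ω : ℕ → ℂ) : Prop :=
  ∃ g : ℂ → ℂ, AnalyticAt ℂ g 1 ∧
    ∀ᶠ ζ : ℂ in 𝓝 1, ‖ζ‖ < 1 →
      HasSum (fun n : ℕ => ω n * ζ ^ n) ((1 - ζ) ^ (-(α : ℂ)) * g ζ)

end

/-!
Write `W = ∑ ω_n X ^ n` and `P_γ = ∑ n ^ (γ - 1) / Γ(γ) X ^ n`. Since `I_s^α` sends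
`e ^ (-σ t) t ^ (β - 1) / Γ(β)` to `e ^ (-σ t) t ^ (α + β - 1) / Γ(α + β)`, even in the finite part
sense, the error at `x = n h = 1` is, up to constants, `h ^ (α + β - 1)` times the `n`-th
coefficient of `W P_β - P_{α + β}`: the factor `e ^ (-σ t)` drops out, and convergence is a
statement on the growth of these coefficients.

Both series have expansions in powers of `1 - ζ` at `ζ = 1`. For `P_γ` the expansion is that of
`(1 - ζ) ^ (-γ) (-log ζ / (1 - ζ)) ^ (-γ)`, and cut off after `p` terms it gives the coefficients
up to `O(n ^ (Re γ - 1 - p))`. If `W` is stable, an expansion of `W P_β` holds up to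
`O(n ^ (α - 1))`, although the values of `W` are known near `ζ = 1` only: `(1 - X) ^ m P_β` has
rapidly decaying coefficients for large `m`, so those of `(1 - X) ^ m W P_β` are `O(n ^ (α - 1))`,
and a smooth cutoff on the unit circle, acting as a Toeplitz operator, allows division by
`(1 - X) ^ m` away from `ζ = 1`. Comparing the two expansions for large `Re β` identifies the first
`p` Taylor coefficients of `g(ζ)` and `(-log ζ / (1 - ζ)) ^ (-α)` at `ζ = 1`, which is consistency.
Stability follows from convergence for `β = 1`: `P_1` is the geometric series, so multiplication by
`1 - X` recovers `W` from `W P_1`.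
-/

open Filter Topology PowerSeries Asymptotics MeasureTheory
open Finset.HasAntidiagonal (antidiagonal mem_antidiagonal)

/-! ### Coefficients of polynomial growth -/

/-- The coefficients of `f` are `O(n ^ c)`. -/
def HasCoeffBound (f : ℂ⟦X⟧) (c : ℝ) : Prop :=
  (fun n : ℕ => coeff n f) =O[atTop] fun n : ℕ => (n : ℝ) ^ c

theorem isBigO_natCast_rpow_rpow {c d : ℝ} (h : c ≤ d) :
    (fun n : ℕ => (n : ℝ) ^ c) =O[atTop] fun n : ℕ => (n : ℝ) ^ d := by
  refine .of_bound' ((eventually_ge_atTop 1).mono fun n hn => ?_)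
  rw [Real.norm_of_nonneg (by positivity), Real.norm_of_nonneg (by positivity)]
  exact Real.rpow_le_rpow_of_exponent_le (by exact_mod_cast hn) h

theorem isTheta_natCast_add_one_rpow (c : ℝ) :
    (fun n : ℕ => ((n : ℝ) + 1) ^ c) =Θ[atTop] fun n : ℕ => (n : ℝ) ^ c := by
  have h : (fun n : ℕ => (n : ℝ) + 1) ~[atTop] fun n : ℕ => (n : ℝ) :=
    IsEquivalent.refl.add_const_of_norm_tendsto_atTop
      (tendsto_norm_atTop_atTop.comp tendsto_natCast_atTop_atTop)
  exact (h.rpow fun n => n.cast_nonneg).isTheta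

theorem add_one_rpow_le_mul {a b : ℝ} (ha : 0 ≤ a) (hb : 0 ≤ b) (c : ℝ) :
    (a + 1) ^ c ≤ (b + 1) ^ c * (1 + |a - b|) ^ |c| := by
  have key {x y : ℝ} (hy : 0 ≤ y) : x + 1 ≤ (y + 1) * (1 + |x - y|) := by
    nlinarith [le_abs_self (x - y), abs_nonneg (x - y)]
  rcases le_total 0 c with hc | hc
  · rw [abs_of_nonneg hc, ← Real.mul_rpow (by positivity) (by positivity)]
    exact Real.rpow_le_rpow (by positivity) (key hb) hc
  · rw [abs_of_nonpos hc, Real.rpow_neg (by positivity), ← div_eq_mul_inv,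
      le_div_iff₀ (by positivity), ← Real.mul_rpow (by positivity) (by positivity), abs_sub_comm]
    exact Real.rpow_le_rpow_of_nonpos (by positivity) (key ha) hc

theorem summable_nat_add_one_rpow {s : ℝ} (hs : s < -1) :
    Summable fun n : ℕ => ((n : ℝ) + 1) ^ s := by
  simpa using (summable_nat_add_iff 1).2 (Real.summable_nat_rpow.2 hs)

namespace HasCoeffBound

variable {f g : ℂ⟦X⟧} {c d : ℝ}

theorem iff_exists :
    HasCoeffBound f c ↔ ∃ C : ℝ, ∀ n : ℕ, ‖coeff n f‖ ≤ C * ((n : ℝ) + 1) ^ c := by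
  have h0 (n : ℕ) : 0 < ((n : ℝ) + 1) ^ c := by positivity
  rw [HasCoeffBound, ← (isTheta_natCast_add_one_rpow c).isBigO_congr_right,
    isBigO_nat_atTop_iff fun n hn => absurd hn (h0 n).ne']
  simp only [Real.norm_of_nonneg (h0 _).le]

theorem exists_nonneg (hf : HasCoeffBound f c) :
    ∃ C : ℝ, 0 ≤ C ∧ ∀ n : ℕ, ‖coeff n f‖ ≤ C * ((n : ℝ) + 1) ^ c := by
  obtain ⟨C, hC⟩ := iff_exists.1 hf
  refine ⟨max C 0, le_max_right _ _, fun n => (hC n).trans ?_⟩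
  gcongr
  exact le_max_left _ _

theorem iff_exists_one_le :
    HasCoeffBound f c ↔ ∃ C : ℝ, ∀ n : ℕ, 1 ≤ n → ‖coeff n f‖ ≤ C * (n : ℝ) ^ c := by
  constructor
  · intro h
    obtain ⟨C, -, hC⟩ := bound_of_isBigO_nat_atTop h
    refine ⟨C, fun n hn => ?_⟩
    have hn0 : 0 < (n : ℝ) ^ c := Real.rpow_pos_of_pos (by exact_mod_cast hn) c
    simpa only [Real.norm_of_nonneg hn0.le] using hC hn0.ne'
  · rintro ⟨C, hC⟩
    refine .of_bound C ((eventually_ge_atTop 1).mono fun n hn => ?_)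
    simpa only [Real.norm_of_nonneg (Real.rpow_nonneg n.cast_nonneg c)] using hC n hn

theorem max_iff :
    HasCoeffBound f (max c d) ↔
      ∃ C : ℝ, ∀ n : ℕ, 1 ≤ n → ‖coeff n f‖ ≤ C * ((n : ℝ) ^ c + (n : ℝ) ^ d) := by
  have hmono {a b : ℝ} (hab : a ≤ b) {n : ℕ} (hn : 1 ≤ n) : (n : ℝ) ^ a ≤ (n : ℝ) ^ b :=
    Real.rpow_le_rpow_of_exponent_le (by exact_mod_cast hn) hab
  rw [iff_exists_one_le]
  constructor
  · rintro ⟨C, hC⟩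
    refine ⟨max C 0, fun n hn => (hC n hn).trans ?_⟩
    gcongr
    · exact le_max_left _ _
    · rcases max_choice c d with h | h <;> rw [h]
      exacts [le_add_of_nonneg_right (by positivity), le_add_of_nonneg_left (by positivity)]
  · rintro ⟨C, hC⟩
    refine ⟨max C 0 * 2, fun n hn => (hC n hn).trans ?_⟩
    rw [mul_assoc, two_mul]
    gcongr ?_ * (?_ + ?_)
    exacts [le_max_left _ _, hmono (le_max_left c d) hn, hmono (le_max_right c d) hn]

theorem mono (hf : HasCoeffBound f c) (h : c ≤ d) : HasCoeffBound f d :=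
  hf.trans (isBigO_natCast_rpow_rpow h)

theorem add (hf : HasCoeffBound f c) (hg : HasCoeffBound g c) : HasCoeffBound (f + g) c := by
  simpa only [HasCoeffBound, map_add] using IsBigO.add hf hg

theorem sub (hf : HasCoeffBound f c) (hg : HasCoeffBound g c) : HasCoeffBound (f - g) c := by
  simpa only [HasCoeffBound, map_sub] using IsBigO.sub hf hg

theorem const_mul (hf : HasCoeffBound f c) (a : ℂ) : HasCoeffBound (C a * f) c := by
  simpa only [HasCoeffBound, coeff_C_mul] using IsBigO.const_mul_left hf a

theorem sum {ι : Type*} {s : Finset ι} {F : ι → ℂ⟦X⟧} (h : ∀ i ∈ s, HasCoeffBound (F i) c) :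
    HasCoeffBound (∑ i ∈ s, F i) c := by
  simpa only [HasCoeffBound, map_sum] using IsBigO.fun_sum h

theorem of_eventually_eq_zero (h : ∀ᶠ n : ℕ in atTop, coeff n f = 0) (c : ℝ) :
    HasCoeffBound f c :=
  (isBigO_zero _ _).congr' (h.mono fun _ hn => hn.symm) .rfl

theorem mul (hf : HasCoeffBound f c) (hg : HasCoeffBound g d) (h : |c| + d < -1) :
    HasCoeffBound (f * g) c := by
  obtain ⟨C, hC0, hC⟩ := hf.exists_nonneg
  obtain ⟨D, hD0, hD⟩ := hg.exists_nonneg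
  have term_le {n i j : ℕ} (hij : i + j = n) : ‖coeff i f * coeff j g‖ ≤
      C * D * ((n : ℝ) + 1) ^ c * ((j : ℝ) + 1) ^ (|c| + d) := by
    have hi := add_one_rpow_le_mul i.cast_nonneg (n.cast_nonneg : (0 : ℝ) ≤ n) c
    have hj : |(i : ℝ) - n| = j := by rw [← hij, Nat.cast_add, sub_add_cancel_left, abs_neg,
      abs_of_nonneg j.cast_nonneg]
    rw [hj, add_comm 1] at hi
    calc ‖coeff i f * coeff j g‖ = ‖coeff i f‖ * ‖coeff j g‖ := norm_mul _ _
      _ ≤ (C * (((n : ℝ) + 1) ^ c * ((j : ℝ) + 1) ^ |c|)) * (D * ((j : ℝ) + 1) ^ d) := by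
          gcongr
          exacts [(hC _).trans (by gcongr), hD _]
      _ = _ := by rw [Real.rpow_add (by positivity)]; ring
  refine iff_exists.2 ⟨C * D * ∑' k : ℕ, ((k : ℝ) + 1) ^ (|c| + d), fun n => ?_⟩
  calc ‖coeff n (f * g)‖
      ≤ ∑ q ∈ antidiagonal n,
          C * D * ((n : ℝ) + 1) ^ c * ((q.2 : ℝ) + 1) ^ (|c| + d) := by
        rw [coeff_mul]
        exact norm_sum_le_of_le _ fun q hq => term_le (mem_antidiagonal.1 hq)
    _ = C * D * ((n : ℝ) + 1) ^ c * ∑ k ∈ Finset.range (n + 1), ((k : ℝ) + 1) ^ (|c| + d) := by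
        rw [← Finset.mul_sum, ← Finset.Nat.sum_antidiagonal_swap]
        exact congrArg _ (Finset.Nat.sum_antidiagonal_eq_sum_range_succ_mk
          (fun q : ℕ × ℕ => ((q.1 : ℝ) + 1) ^ (|c| + d)) n)
    _ ≤ C * D * ((n : ℝ) + 1) ^ c * ∑' k : ℕ, ((k : ℝ) + 1) ^ (|c| + d) := by
        gcongr
        exact (summable_nat_add_one_rpow h).sum_le_tsum _ fun i _ => by positivity
    _ = _ := by ring

theorem of_polynomial (q : Polynomial ℂ) (c : ℝ) : HasCoeffBound (q : ℂ⟦X⟧) c :=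
  of_eventually_eq_zero ((eventually_gt_atTop q.natDegree).mono fun n hn => by
    rw [Polynomial.coeff_coe, Polynomial.coeff_eq_zero_of_natDegree_lt hn]) c

theorem mul_polynomial (hf : HasCoeffBound f c) (q : Polynomial ℂ) :
    HasCoeffBound (f * (q : ℂ⟦X⟧)) c :=
  hf.mul (of_polynomial q (-|c| - 2)) (by linarith)

theorem mul_one_sub_X_pow (hf : HasCoeffBound f c) (m : ℕ) :
    HasCoeffBound (f * (1 - X) ^ m) c := by
  have e : (1 - X : ℂ⟦X⟧) ^ m = ((1 - Polynomial.X) ^ m : Polynomial ℂ) := by push_cast; rfl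
  exact e ▸ hf.mul_polynomial _

theorem summable_mul_pow (hf : HasCoeffBound f c) {ζ : ℂ} (hζ : ‖ζ‖ < 1) :
    Summable fun n : ℕ => ‖coeff n f * ζ ^ n‖ := by
  obtain ⟨k, hk⟩ := exists_nat_ge c
  have h1 : (fun n : ℕ => ‖coeff n f * ζ ^ n‖) =O[atTop] fun n : ℕ => (n : ℝ) ^ k * ‖ζ‖ ^ n := by
    simp only [norm_mul, norm_pow]
    simpa only [Real.rpow_natCast] using (hf.mono hk).norm_left.mul (isBigO_refl _ _)
  exact summable_of_isBigO_nat (summable_pow_mul_geometric_of_norm_lt_one k (by simpa)) h1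

theorem hasSum_mul (hf : HasCoeffBound f c) (hg : HasCoeffBound g d) {ζ F G : ℂ} (hζ : ‖ζ‖ < 1)
    (hF : HasSum (fun n : ℕ => coeff n f * ζ ^ n) F)
    (hG : HasSum (fun n : ℕ => coeff n g * ζ ^ n) G) :
    HasSum (fun n : ℕ => coeff n (f * g) * ζ ^ n) (F * G) := by
  have e : (fun n : ℕ => coeff n (f * g) * ζ ^ n) = fun n : ℕ =>
      ∑ q ∈ antidiagonal n, (coeff q.1 f * ζ ^ q.1) * (coeff q.2 g * ζ ^ q.2) := by
    funext n
    rw [coeff_mul, Finset.sum_mul]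
    refine Finset.sum_congr rfl fun q hq => ?_
    rw [← mem_antidiagonal.1 hq, pow_add]
    ring
  have h1 := hf.summable_mul_pow hζ
  have h2 := hg.summable_mul_pow hζ
  rw [e, ← hF.tsum_eq, ← hG.tsum_eq,
    tsum_mul_tsum_eq_tsum_sum_antidiagonal_of_summable_norm h1 h2]
  exact (summable_norm_sum_mul_antidiagonal_of_summable_norm h1 h2).of_norm.hasSum

end HasCoeffBound

/-! ### The binomial series of `(1 - X) ^ (-γ)` -/

/-- The power series of `(1 - X) ^ (-γ)`. -/
noncomputable def oneSubCPow (γ : ℂ) : ℂ⟦X⟧ :=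
  rescale (-1) (PowerSeries.binomialSeries ℂ (-γ))

theorem coeff_oneSubCPow (γ : ℂ) (n : ℕ) :
    coeff n (oneSubCPow γ) = Ring.choose (γ + n - 1) n := by
  rw [oneSubCPow, coeff_rescale, binomialSeries_coeff, Ring.choose_neg]
  simp [Units.smul_def, ← mul_assoc, ← pow_add]

theorem oneSubCPow_add (γ δ : ℂ) : oneSubCPow (γ + δ) = oneSubCPow γ * oneSubCPow δ := by
  rw [oneSubCPow, neg_add, binomialSeries_add, map_mul]
  rfl

theorem oneSubCPow_sub_natCast (γ : ℂ) (k : ℕ) :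
    oneSubCPow (γ - k) = oneSubCPow γ * (1 - X) ^ k := by
  have h : oneSubCPow (-(k : ℂ)) = (1 - X) ^ k := by
    rw [oneSubCPow, neg_neg, binomialSeries_nat, map_pow, map_add, map_one, rescale_X]
    simp [sub_eq_add_neg]
  rw [sub_eq_add_neg, oneSubCPow_add, h]

theorem coeff_oneSubCPow_eq_prod (γ : ℂ) (n : ℕ) :
    coeff n (oneSubCPow γ) = (∏ j ∈ Finset.range n, (γ + j)) / n.factorial := by
  rw [coeff_oneSubCPow, ← Ring.multichoose_eq, eq_div_iff (by exact_mod_cast n.factorial_ne_zero),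
    mul_comm, ← nsmul_eq_mul, Ring.factorial_nsmul_multichoose_eq_ascPochhammer,
    Polynomial.ascPochhammer_smeval_eq_eval]
  induction n with
  | zero => simp
  | succ n ih => rw [ascPochhammer_succ_eval, ih, Finset.prod_range_succ]

-- This is `ζ d/dζ (1 - ζ) ^ (-γ) = γ ((1 - ζ) ^ (-γ - 1) - (1 - ζ) ^ (-γ))`.
theorem natCast_mul_coeff_oneSubCPow (γ : ℂ) (n : ℕ) :
    (n : ℂ) * coeff n (oneSubCPow γ) =
      γ * (coeff n (oneSubCPow (γ + 1)) - coeff n (oneSubCPow γ)) := by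
  have h : γ * coeff n (oneSubCPow (γ + 1)) = (γ + n) * coeff n (oneSubCPow γ) := by
    rw [coeff_oneSubCPow_eq_prod, coeff_oneSubCPow_eq_prod, ← mul_div_assoc, ← mul_div_assoc,
      mul_comm (γ + n), ← Finset.prod_range_succ (fun j : ℕ => γ + (j : ℂ)),
      Finset.prod_range_succ' (fun j : ℕ => γ + (j : ℂ)), mul_comm γ]
    simp only [Nat.cast_add, Nat.cast_one, Nat.cast_zero, add_zero, add_assoc, add_comm (1 : ℂ)]
  rw [mul_sub, h]
  ring

theorem tendsto_coeff_oneSubCPow (γ : ℂ) :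
    Tendsto (fun n : ℕ => coeff n (oneSubCPow γ) * (n : ℂ) ^ (1 - γ)) atTop
      (𝓝 (Complex.Gamma γ)⁻¹) := by
  by_cases hγ : ∃ m : ℕ, γ = -m
  · obtain ⟨m, rfl⟩ := hγ
    rw [(Complex.Gamma_eq_zero_iff _).2 ⟨m, rfl⟩, inv_zero]
    refine tendsto_const_nhds.congr' ?_
    filter_upwards [eventually_gt_atTop m] with n hn
    rw [coeff_oneSubCPow_eq_prod, Finset.prod_eq_zero (Finset.mem_range.2 hn) (by simp), zero_div,
      zero_mul]
  · push Not at hγ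
    have h1 := (Complex.GammaSeq_tendsto_Gamma γ).inv₀ (Complex.Gamma_ne_zero hγ)
    have h2 : Tendsto (fun n : ℕ => (n : ℂ) / (γ + n)) atTop (𝓝 1) := by
      simpa [add_comm] using tendsto_natCast_div_add_atTop γ
    refine ((h1.mul h2).congr' ?_).trans (by rw [mul_one])
    filter_upwards [eventually_gt_atTop 0] with n hn
    have hn0 : (n : ℂ) ≠ 0 := by exact_mod_cast hn.ne'
    have hγn : γ + n ≠ 0 := fun h => hγ n (eq_neg_of_add_eq_zero_left h)
    have hf : (n.factorial : ℂ) ≠ 0 := by exact_mod_cast n.factorial_ne_zero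
    have hc : (n : ℂ) ^ γ ≠ 0 := by simp [Complex.cpow_eq_zero_iff, hn0]
    rw [Complex.GammaSeq, coeff_oneSubCPow_eq_prod, Finset.prod_range_succ,
      Complex.cpow_sub _ _ hn0, Complex.cpow_one]
    field_simp

theorem isTheta_natCast_cpow (s : ℂ) :
    (fun n : ℕ => (n : ℂ) ^ s) =Θ[atTop] fun n : ℕ => (n : ℝ) ^ s.re := by
  refine .of_norm_eventuallyEq ?_
  filter_upwards [eventually_gt_atTop 0] with n hn
  exact Complex.norm_natCast_cpow_of_pos hn s

theorem hasCoeffBound_oneSubCPow (γ : ℂ) : HasCoeffBound (oneSubCPow γ) (γ.re - 1) := by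
  have h := ((tendsto_coeff_oneSubCPow γ).isBigO_one ℝ).mul (isTheta_natCast_cpow (γ - 1)).isBigO
  refine h.congr' ?_ (by simp)
  filter_upwards [eventually_gt_atTop 0] with n hn
  have hn0 : (n : ℂ) ≠ 0 := by exact_mod_cast hn.ne'
  rw [mul_assoc, ← Complex.cpow_add _ _ hn0, sub_add_sub_cancel, sub_self, Complex.cpow_zero,
    mul_one]

theorem hasSum_oneSubCPow (γ : ℂ) {ζ : ℂ} (hζ : ‖ζ‖ < 1) :
    HasSum (fun n : ℕ => coeff n (oneSubCPow γ) * ζ ^ n) ((1 - ζ) ^ (-γ)) := by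
  have h := (Complex.one_div_one_sub_cpow_hasFPowerSeriesOnBall_zero γ).hasSum (y := ζ)
    (by rw [← ENNReal.ofReal_one, Metric.eball_ofReal]; simpa using hζ)
  simp only [FormalMultilinearSeries.ofScalars_apply_eq, zero_add, smul_eq_mul] at h
  rw [Complex.cpow_neg, ← one_div]
  simpa only [coeff_oneSubCPow] using h

/-! ### Taylor series at the origin -/

/-- The Taylor series of `f` at `0`. -/
noncomputable def taylorSeries (f : ℂ → ℂ) : ℂ⟦X⟧ :=
  PowerSeries.mk fun n => iteratedDeriv n f 0 / n.factorial

theorem coeff_taylorSeries (f : ℂ → ℂ) (n : ℕ) :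
    coeff n (taylorSeries f) = iteratedDeriv n f 0 / n.factorial :=
  coeff_mk _ _

section TaylorSeries

variable {f g : ℂ → ℂ}

theorem taylorSeries_congr (h : f =ᶠ[𝓝 0] g) : taylorSeries f = taylorSeries g := by
  ext n
  rw [coeff_taylorSeries, coeff_taylorSeries, h.iteratedDeriv_eq]

theorem taylorSeries_mul (hf : AnalyticAt ℂ f 0) (hg : AnalyticAt ℂ g 0) :
    taylorSeries (fun x => f x * g x) = taylorSeries f * taylorSeries g := by
  ext n
  rw [coeff_taylorSeries, coeff_mul, Finset.Nat.sum_antidiagonal_eq_sum_range_succ_mk,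
    iteratedDeriv_fun_mul hf.contDiffAt hg.contDiffAt, Finset.sum_div]
  refine Finset.sum_congr rfl fun i hi => ?_
  rw [coeff_taylorSeries, coeff_taylorSeries, Nat.cast_choose _ (by grind)]
  field_simp [Nat.factorial_ne_zero]

theorem taylorSeries_sub (hf : AnalyticAt ℂ f 0) (hg : AnalyticAt ℂ g 0) :
    taylorSeries (fun x => f x - g x) = taylorSeries f - taylorSeries g := by
  ext n
  rw [map_sub, coeff_taylorSeries, coeff_taylorSeries, coeff_taylorSeries,
    iteratedDeriv_fun_sub hf.contDiffAt hg.contDiffAt, sub_div]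

theorem taylorSeries_sum {ι : Type*} {s : Finset ι} {F : ι → ℂ → ℂ}
    (h : ∀ i ∈ s, AnalyticAt ℂ (F i) 0) :
    taylorSeries (fun x => ∑ i ∈ s, F i x) = ∑ i ∈ s, taylorSeries (F i) := by
  ext n
  simp only [map_sum, coeff_taylorSeries, ← Finset.sum_div]
  rw [iteratedDeriv_fun_sum fun i hi => (h i hi).contDiffAt]

theorem taylorSeries_const (a : ℂ) : taylorSeries (fun _ => a) = C a := by
  ext n
  rw [coeff_taylorSeries, iteratedDeriv_const, coeff_C]
  split_ifs with h <;> simp [h]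

theorem taylorSeries_pow_id (k : ℕ) : taylorSeries (fun x => x ^ k) = X ^ k := by
  ext n
  rw [coeff_taylorSeries, iteratedDeriv_fun_pow_zero, coeff_X_pow]
  split_ifs with h <;> simp [h, Nat.factorial_ne_zero]

theorem taylorSeries_id : taylorSeries (fun x => x) = X := by
  simpa using taylorSeries_pow_id 1

theorem taylorSeries_deriv (f : ℂ → ℂ) :
    taylorSeries (deriv f) = derivative ℂ (taylorSeries f) := by
  ext n
  rw [coeff_derivative, coeff_taylorSeries, coeff_taylorSeries, iteratedDeriv_succ',
    Nat.factorial_succ]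
  push_cast
  field_simp

theorem exists_eventuallyEq_taylorSeries_add (hf : AnalyticAt ℂ f 0) (N : ℕ) :
    ∃ r : ℂ → ℂ, AnalyticAt ℂ r 0 ∧
      ∀ᶠ x in 𝓝 0, f x = ∑ k ∈ Finset.range N, coeff k (taylorSeries f) * x ^ k + x ^ N * r x := by
  obtain ⟨r, hr, h⟩ := hf.exists_eventuallyEq_sum_add_pow_mul N
  refine ⟨r, hr, h.mono fun x hx => hx.trans ?_⟩
  congr! 2 with k
  rw [coeff_taylorSeries, smul_eq_mul]
  ring

theorem X_pow_dvd_taylorSeries_iff_analyticOrderAt (hf : AnalyticAt ℂ f 0) {p : ℕ} :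
    X ^ p ∣ taylorSeries f ↔ p ≤ analyticOrderAt f 0 := by
  simp only [X_pow_dvd_iff, natCast_le_analyticOrderAt_iff_iteratedDeriv_eq_zero hf,
    coeff_taylorSeries, div_eq_zero_iff, Nat.cast_eq_zero, Nat.factorial_ne_zero, or_false]

theorem X_pow_dvd_taylorSeries_iff_isBigO (hf : AnalyticAt ℂ f 0) {l : Filter ℂ} [l.NeBot]
    (hl : l ≤ 𝓝[≠] 0) {p : ℕ} : X ^ p ∣ taylorSeries f ↔ f =O[l] fun x => x ^ p := by
  have hl0 : l ≤ 𝓝 0 := hl.trans nhdsWithin_le_nhds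
  rw [X_pow_dvd_taylorSeries_iff_analyticOrderAt hf]
  refine ⟨fun h => ?_, fun h => ?_⟩
  · obtain ⟨g, hg, hfg⟩ := (natCast_le_analyticOrderAt hf).1 h
    have hg1 : g =O[l] fun _ => (1 : ℂ) := (hg.continuousAt.tendsto.isBigO_one ℂ).mono hl0
    simpa using ((isBigO_refl (fun x : ℂ => x ^ p) l).mul hg1).congr'
      ((hfg.filter_mono hl0).mono fun x hx => by simp [hx]) .rfl
  · by_contra! hlt
    obtain ⟨m, hm⟩ := ENat.ne_top_iff_exists.1 (hlt.trans_le le_top).ne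
    obtain ⟨g, hg, hg0, hfg⟩ := (hf.analyticOrderAt_eq_natCast).1 hm.symm
    have hmp : m < p := by rw [← hm] at hlt; exact_mod_cast hlt
    have hgO : g =O[l] fun x => x ^ (p - m) := by
      refine (h.mul (isBigO_refl (fun x : ℂ => (x ^ m)⁻¹) l)).congr' ?_ ?_
      · filter_upwards [hfg.filter_mono hl0, hl self_mem_nhdsWithin] with x hx hx0
        rw [hx, sub_zero, smul_eq_mul, mul_right_comm, mul_inv_cancel₀ (pow_ne_zero m hx0), one_mul]
      · filter_upwards [hl self_mem_nhdsWithin] with x hx0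
        rw [pow_sub₀ x hx0 hmp.le]
    have hpow : Tendsto (fun x : ℂ => x ^ (p - m)) l (𝓝 0) := by
      simpa [(Nat.sub_pos_of_lt hmp).ne'] using
        ((continuous_pow (p - m)).tendsto (0 : ℂ)).mono_left hl0
    exact hg0 (tendsto_nhds_unique (hg.continuousAt.tendsto.mono_left hl0)
      (hgO.trans_tendsto hpow))

end TaylorSeries

/-! ### The function `(-log (1 - x) / x) ^ (-γ)` -/

/-- The function `-log (1 - x) / x`, with the value `1` at `0`. -/
noncomputable def negLogDiv : ℂ → ℂ := dslope (fun x => -Complex.log (1 - x)) 0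

theorem mul_negLogDiv (x : ℂ) : x * negLogDiv x = -Complex.log (1 - x) := by
  simpa [negLogDiv] using sub_smul_dslope (fun x => -Complex.log (1 - x)) 0 x

theorem hasDerivAt_neg_log_one_sub {x : ℂ} (hx : 1 - x ∈ Complex.slitPlane) :
    HasDerivAt (fun x => -Complex.log (1 - x)) (1 - x)⁻¹ x :=
  (((hasDerivAt_id x).const_sub 1).clog hx).fun_neg.congr_deriv (by simp [neg_div])

theorem eventually_one_sub_mem_slitPlane : ∀ᶠ x : ℂ in 𝓝 0, 1 - x ∈ Complex.slitPlane :=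
  (continuous_const.sub continuous_id).continuousAt.eventually_mem
    (Complex.isOpen_slitPlane.mem_nhds (by simp))

theorem negLogDiv_zero : negLogDiv 0 = 1 := by
  rw [negLogDiv, dslope_same, (hasDerivAt_neg_log_one_sub (by simp)).deriv]
  simp

@[fun_prop]
theorem analyticAt_negLogDiv : AnalyticAt ℂ negLogDiv 0 := by
  have h : AnalyticAt ℂ (fun x => -Complex.log (1 - x)) 0 :=
    ((analyticAt_const.sub analyticAt_id).clog (by simp)).neg
  obtain ⟨q, hq⟩ := h
  exact hq.has_fpower_series_dslope_fslope.analyticAt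

theorem eventually_negLogDiv_mem_slitPlane : ∀ᶠ x : ℂ in 𝓝 0, negLogDiv x ∈ Complex.slitPlane :=
  analyticAt_negLogDiv.continuousAt.eventually_mem
    (Complex.isOpen_slitPlane.mem_nhds (by simp [negLogDiv_zero]))

@[fun_prop]
theorem analyticAt_negLogDiv_cpow (γ : ℂ) : AnalyticAt ℂ (fun x => negLogDiv x ^ (-γ)) 0 :=
  analyticAt_negLogDiv.cpow analyticAt_const (by simp [negLogDiv_zero])

/-- The Taylor series of `(-log (1 - x) / x) ^ (-γ)`. -/
noncomputable def negLogSeries (γ : ℂ) : ℂ⟦X⟧ := taylorSeries fun x => negLogDiv x ^ (-γ)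

theorem negLogSeries_add (γ δ : ℂ) :
    negLogSeries (γ + δ) = negLogSeries γ * negLogSeries δ := by
  rw [negLogSeries, negLogSeries, negLogSeries, ← taylorSeries_mul (by fun_prop) (by fun_prop)]
  refine taylorSeries_congr ?_
  filter_upwards [eventually_negLogDiv_mem_slitPlane] with x hx
  rw [neg_add, Complex.cpow_add _ _ (Complex.slitPlane_ne_zero hx)]

theorem negLogSeries_zero : negLogSeries 0 = 1 := by
  simp only [negLogSeries, neg_zero, Complex.cpow_zero, taylorSeries_const, map_one]

theorem coeff_zero_negLogSeries (γ : ℂ) : coeff 0 (negLogSeries γ) = 1 := by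
  simp [negLogSeries, coeff_taylorSeries, negLogDiv_zero]

theorem C_mul_negLogSeries_add_one (γ : ℂ) : C γ * negLogSeries (γ + 1) =
    (1 - X) * (C γ * negLogSeries γ - X * derivative ℂ (negLogSeries γ)) := by
  have hd : AnalyticAt ℂ (deriv fun x => negLogDiv x ^ (-γ)) 0 :=
    (analyticAt_negLogDiv_cpow γ).deriv
  rw [negLogSeries, negLogSeries, ← taylorSeries_deriv, ← taylorSeries_const γ,
    ← taylorSeries_id, ← map_one C, ← taylorSeries_const 1,
    ← taylorSeries_mul (by fun_prop) (by fun_prop), ← taylorSeries_mul (by fun_prop) (by fun_prop),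
    ← taylorSeries_mul (by fun_prop) hd, ← taylorSeries_sub (by fun_prop) (by fun_prop),
    ← taylorSeries_sub (by fun_prop) (by fun_prop), ← taylorSeries_mul (by fun_prop) (by fun_prop)]
  refine taylorSeries_congr ?_
  filter_upwards [eventually_negLogDiv_mem_slitPlane, eventually_one_sub_mem_slitPlane,
    analyticAt_negLogDiv.eventually_analyticAt] with x hx hx1 hxa
  have hL := hxa.differentiableAt.hasDerivAt
  have deriv_log : (1 - x) * (negLogDiv x + x * deriv negLogDiv x) = 1 := by
    have h : HasDerivAt (fun x => x * negLogDiv x) (1 * negLogDiv x + x * deriv negLogDiv x) x :=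
      (hasDerivAt_id x).mul hL
    simp only [mul_negLogDiv] at h
    rw [← one_mul (negLogDiv x), h.unique (hasDerivAt_neg_log_one_sub hx1),
      mul_inv_cancel₀ (Complex.slitPlane_ne_zero hx1)]
  have cpow_neg_eq : negLogDiv x ^ (-γ) = negLogDiv x ^ (-γ - 1) * negLogDiv x := by
    rw [Complex.cpow_sub _ _ (Complex.slitPlane_ne_zero hx), Complex.cpow_one,
      div_mul_cancel₀ _ (Complex.slitPlane_ne_zero hx)]
  rw [(hL.cpow_const hx).deriv, neg_add', cpow_neg_eq]
  linear_combination -(γ * negLogDiv x ^ (-γ - 1)) * deriv_log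

theorem mul_coeff_negLogSeries_add_one (γ : ℂ) (k : ℕ) :
    γ * coeff (k + 1) (negLogSeries (γ + 1)) =
      (γ - (k + 1)) * coeff (k + 1) (negLogSeries γ) - (γ - k) * coeff k (negLogSeries γ) := by
  have h := congrArg (coeff (k + 1)) (C_mul_negLogSeries_add_one γ)
  rw [coeff_C_mul, sub_mul, one_mul, map_sub, coeff_succ_X_mul, map_sub, map_sub, coeff_C_mul,
    coeff_C_mul, coeff_succ_X_mul, coeff_derivative] at h
  rw [h]
  rcases k with _ | k
  · simp
    ring
  · rw [coeff_succ_X_mul, coeff_derivative]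
    push_cast
    ring

theorem isBigO_one_sub_mul_sum_mul_negLogDiv_pow (K : ℕ) :
    (fun x => (1 - x) * ∑ j ∈ Finset.range (K + 1), (x * negLogDiv x) ^ j / j.factorial - 1)
      =O[𝓝[≠] 0] fun x => x ^ (K + 1) := by
  have hcont : ContinuousAt (fun x => x * negLogDiv x) 0 :=
    continuousAt_id.mul analyticAt_negLogDiv.continuousAt
  have hexp := (Complex.exp_sub_sum_range_isBigO_pow (K + 1)).comp_tendsto
    (hcont.tendsto.trans (by rw [zero_mul]))
  have hL : (fun x => (x * negLogDiv x) ^ (K + 1)) =O[𝓝 0] fun x => x ^ (K + 1) := by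
    simpa using ((isBigO_refl (fun x : ℂ => x) (𝓝 0)).mul
      (analyticAt_negLogDiv.continuousAt.tendsto.isBigO_one ℂ)).pow (K + 1)
  have hsub : (fun x : ℂ => 1 - x) =O[𝓝 0] fun _ => (1 : ℂ) :=
    ((continuous_const.sub continuous_id).tendsto 0).isBigO_one ℂ
  refine (((hsub.mul (hexp.trans hL)).neg_left.congr' ?_ (by simp)).mono nhdsWithin_le_nhds)
  filter_upwards [eventually_one_sub_mem_slitPlane] with x hx
  have exp_eq : Complex.exp (x * negLogDiv x) = (1 - x)⁻¹ := by
    rw [mul_negLogDiv, Complex.exp_neg, Complex.exp_log (Complex.slitPlane_ne_zero hx)]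
  rw [Function.comp_apply, exp_eq, mul_sub, mul_inv_cancel₀ (Complex.slitPlane_ne_zero hx), neg_sub]

-- With `L = -log (1 - x)` the sum is the Taylor polynomial of `exp L = 1 / (1 - x)` in `L`.
theorem X_pow_dvd_one_sub_X_mul_sum_negLogSeries (K : ℕ) :
    X ^ (K + 1) ∣ (1 - X) * ∑ j ∈ Finset.range (K + 1),
      C ((j.factorial : ℂ)⁻¹) * (X ^ j * negLogSeries (-j)) - 1 := by
  set f : ℂ → ℂ := fun x => (1 - x) * ∑ j ∈ Finset.range (K + 1),
    (j.factorial : ℂ)⁻¹ * (x ^ j * negLogDiv x ^ (-(-j : ℂ))) - 1 with hf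
  have hsum (j : ℕ) :
      AnalyticAt ℂ (fun x => (j.factorial : ℂ)⁻¹ * (x ^ j * negLogDiv x ^ (-(-j : ℂ)))) 0 := by
    fun_prop
  have hfa : AnalyticAt ℂ f 0 := by fun_prop
  have key : taylorSeries f = (1 - X) * ∑ j ∈ Finset.range (K + 1),
      C ((j.factorial : ℂ)⁻¹) * (X ^ j * negLogSeries (-j)) - 1 := by
    rw [hf, taylorSeries_sub (by fun_prop) (by fun_prop), taylorSeries_const, map_one,
      taylorSeries_mul (by fun_prop) (by fun_prop), taylorSeries_sub (by fun_prop) (by fun_prop),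
      taylorSeries_id, taylorSeries_const, map_one, taylorSeries_sum fun j _ => hsum j]
    congr! 3 with j
    rw [taylorSeries_mul (by fun_prop) (by fun_prop), taylorSeries_mul (by fun_prop) (by fun_prop),
      taylorSeries_const, taylorSeries_pow_id, negLogSeries]
  rw [← key, X_pow_dvd_taylorSeries_iff_isBigO hfa le_rfl, hf]
  simpa only [neg_neg, Complex.cpow_natCast, mul_pow, div_eq_inv_mul] using
    isBigO_one_sub_mul_sum_mul_negLogDiv_pow K

/-! ### Expansions in powers of `1 - X` -/

/-- The first `N` terms of `(1 - X) ^ (-γ) * S (1 - X)`. -/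
noncomputable def expandAtOne (γ : ℂ) (S : ℂ⟦X⟧) (N : ℕ) : ℂ⟦X⟧ :=
  ∑ k ∈ Finset.range N, C (coeff k S) * oneSubCPow (γ - k)

theorem coeff_expandAtOne (γ : ℂ) (S : ℂ⟦X⟧) (N n : ℕ) : coeff n (expandAtOne γ S N) =
    ∑ k ∈ Finset.range N, coeff k S * coeff n (oneSubCPow (γ - k)) := by
  simp only [expandAtOne, map_sum, coeff_C_mul]

theorem hasCoeffBound_expandAtOne (γ : ℂ) (S : ℂ⟦X⟧) (N : ℕ) :
    HasCoeffBound (expandAtOne γ S N) (γ.re - 1) :=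
  .sum fun k _ => ((hasCoeffBound_oneSubCPow _).const_mul _).mono (by simp)

theorem expandAtOne_eq_mul_aeval (γ : ℂ) (S : ℂ⟦X⟧) (N : ℕ) :
    expandAtOne γ S N = oneSubCPow γ * Polynomial.aeval (1 - X : ℂ⟦X⟧) (trunc N S) := by
  rw [Polynomial.aeval_def, eval₂_trunc_eq_sum_range, expandAtOne, Finset.mul_sum]
  refine Finset.sum_congr rfl fun k _ => ?_
  rw [oneSubCPow_sub_natCast, PowerSeries.algebraMap_apply, Algebra.algebraMap_self_apply]
  ring

theorem expandAtOne_eq_zero {S : ℂ⟦X⟧} {p : ℕ} (h : X ^ p ∣ S) (γ : ℂ) :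
    expandAtOne γ S p = 0 := by
  rw [X_pow_dvd_iff] at h
  refine Finset.sum_eq_zero fun k hk => ?_
  rw [h k (Finset.mem_range.1 hk), map_zero, zero_mul]

theorem expandAtOne_sub (γ : ℂ) (S T : ℂ⟦X⟧) (p : ℕ) :
    expandAtOne γ (S - T) p = expandAtOne γ S p - expandAtOne γ T p := by
  simp only [expandAtOne, ← Finset.sum_sub_distrib, map_sub, sub_mul]

theorem hasCoeffBound_expandAtOne_sub_expandAtOne (γ : ℂ) (S : ℂ⟦X⟧) {M N : ℕ} (h : M ≤ N) :
    HasCoeffBound (expandAtOne γ S N - expandAtOne γ S M) (γ.re - 1 - M) := by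
  rw [expandAtOne, expandAtOne, ← Finset.sum_Ico_eq_sub _ h]
  refine .sum fun k hk => ((hasCoeffBound_oneSubCPow _).const_mul _).mono ?_
  have : (M : ℝ) ≤ k := by exact_mod_cast (Finset.mem_Ico.1 hk).1
  simp only [Complex.sub_re, Complex.natCast_re]
  linarith

theorem hasCoeffBound_oneSubCPow_mul_aeval (γ : ℂ) {q : Polynomial ℂ} {p : ℕ}
    (h : Polynomial.X ^ p ∣ q) :
    HasCoeffBound (oneSubCPow γ * Polynomial.aeval (1 - X : ℂ⟦X⟧) q) (γ.re - 1 - p) := by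
  obtain ⟨D, rfl⟩ := h
  rw [map_mul, map_pow, Polynomial.aeval_X, ← mul_assoc, ← oneSubCPow_sub_natCast,
    Polynomial.aeval_eq_sum_range, Finset.mul_sum]
  refine .sum fun k _ => ?_
  rw [smul_eq_C_mul, mul_left_comm, ← oneSubCPow_sub_natCast]
  refine ((hasCoeffBound_oneSubCPow _).const_mul _).mono ?_
  simp only [Complex.sub_re, Complex.natCast_re]
  linarith [(k.cast_nonneg : (0 : ℝ) ≤ k)]

theorem hasCoeffBound_expandAtOne_mul_sub (γ δ : ℂ) (S T : ℂ⟦X⟧) {p N : ℕ} (h : p ≤ N) :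
    HasCoeffBound (expandAtOne γ S N * expandAtOne δ T N - expandAtOne (γ + δ) (S * T) p)
      (γ.re + δ.re - 1 - p) := by
  have hdvd : Polynomial.X ^ p ∣ trunc N S * trunc N T - trunc p (S * T) := by
    rw [Polynomial.X_pow_dvd_iff]
    intro d hd
    rw [Polynomial.coeff_sub, coeff_trunc, if_pos hd,
      coeff_mul_eq_coeff_trunc_mul_trunc S T (hd.trans_le h), ← Polynomial.coe_mul,
      Polynomial.coeff_coe, sub_self]
  rw [← Complex.add_re]
  convert hasCoeffBound_oneSubCPow_mul_aeval (γ + δ) hdvd using 1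
  simp only [expandAtOne_eq_mul_aeval, oneSubCPow_add, map_sub, map_mul]
  ring

theorem hasSum_expandAtOne (γ : ℂ) (S : ℂ⟦X⟧) (N : ℕ) {ζ : ℂ} (hζ : ‖ζ‖ < 1) :
    HasSum (fun n : ℕ => coeff n (expandAtOne γ S N) * ζ ^ n)
      ((1 - ζ) ^ (-γ) * ∑ k ∈ Finset.range N, coeff k S * (1 - ζ) ^ k) := by
  have hζ1 : 1 - ζ ≠ 0 := sub_ne_zero.2 fun h => by simp [← h] at hζ
  have cpow_eq (k : ℕ) : (1 - ζ) ^ (-γ) * (coeff k S * (1 - ζ) ^ k) =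
      coeff k S * (1 - ζ) ^ (-(γ - k)) := by
    rw [neg_sub, sub_eq_neg_add (k : ℂ) γ, Complex.cpow_add _ _ hζ1, Complex.cpow_natCast]
    ring
  have h := hasSum_sum (s := Finset.range N) fun k _ =>
    (hasSum_oneSubCPow (γ - k) hζ).mul_left (coeff k S)
  simp only [← cpow_eq, ← Finset.mul_sum, ← mul_assoc (coeff _ S), ← Finset.sum_mul,
    ← coeff_expandAtOne] at h
  exact h

/-! ### Expansion of `n ^ (γ - 1) / Γ(γ)` -/

theorem mul_add_one_rpow_le_sub {s x : ℝ} (hs : 0 ≤ s) (hx : 0 < x) :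
    s * (x + 1) ^ (-s - 1) ≤ x ^ (-s) - (x + 1) ^ (-s) := by
  have hx1 : 0 < x + 1 := by positivity
  have one_add_le : 1 + s / (x + 1) ≤ ((x + 1) / x) ^ s := by
    have hlog := Real.one_sub_inv_le_log_of_pos (div_pos hx1 hx)
    rw [inv_div, one_sub_div hx1.ne', add_sub_cancel_left] at hlog
    calc 1 + s / (x + 1) = s * (1 / (x + 1)) + 1 := by ring
      _ ≤ s * Real.log ((x + 1) / x) + 1 := by gcongr
      _ ≤ Real.exp (s * Real.log ((x + 1) / x)) := Real.add_one_le_exp _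
      _ = ((x + 1) / x) ^ s := by rw [Real.rpow_def_of_pos (by positivity), mul_comm]
  rw [Real.rpow_sub_one hx1.ne', le_sub_iff_add_le]
  calc s * ((x + 1) ^ (-s) / (x + 1)) + (x + 1) ^ (-s)
      = (x + 1) ^ (-s) * (1 + s / (x + 1)) := by ring
    _ ≤ (x + 1) ^ (-s) * ((x + 1) / x) ^ s := by gcongr
    _ = x ^ (-s) := by
      rw [Real.div_rpow hx1.le hx.le, Real.rpow_neg hx1.le, Real.rpow_neg hx.le]
      field_simp

theorem isBigO_sub_of_isBigO_succ_sub {E : Type*} [NormedAddCommGroup E] {u : ℕ → E} {L : E}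
    {s : ℝ} (hs : 0 < s)
    (hu : (fun n => u (n + 1) - u n) =O[atTop] fun n : ℕ => (n : ℝ) ^ (-s - 1))
    (hL : Tendsto u atTop (𝓝 L)) : (fun n => u n - L) =O[atTop] fun n : ℕ => (n : ℝ) ^ (-s) := by
  obtain ⟨C, hC, hbound⟩ :=
    (hu.trans_isTheta (isTheta_natCast_add_one_rpow (-s - 1)).symm).exists_pos
  obtain ⟨N, hN⟩ := eventually_atTop.1 hbound.bound
  refine .of_bound (C / s) ((eventually_ge_atTop (max N 1)).mono fun n hn => ?_)
  have norm_sub_le {m : ℕ} (hm : n ≤ m) :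
      ‖u n - u m‖ ≤ C / s * ((n : ℝ) ^ (-s) - (m : ℝ) ^ (-s)) := by
    induction m, hm using Nat.le_induction with
    | base => simp
    | succ m hm ih =>
      have hm0 : (0 : ℝ) < m := by exact_mod_cast ((le_max_right N 1).trans hn).trans hm
      have hstep := hN m (((le_max_left N 1).trans hn).trans hm)
      rw [Real.norm_of_nonneg (by positivity), norm_sub_rev] at hstep
      calc ‖u n - u (m + 1)‖
          ≤ ‖u n - u m‖ + ‖u m - u (m + 1)‖ := norm_sub_le_norm_sub_add_norm_sub ..
        _ ≤ C / s * ((n : ℝ) ^ (-s) - (m : ℝ) ^ (-s)) +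
            C / s * (s * ((m : ℝ) + 1) ^ (-s - 1)) := by
          refine add_le_add ih (hstep.trans_eq ?_)
          field_simp
        _ ≤ C / s * ((n : ℝ) ^ (-s) - (m : ℝ) ^ (-s)) +
            C / s * ((m : ℝ) ^ (-s) - ((m : ℝ) + 1) ^ (-s)) := by
          gcongr
          exact mul_add_one_rpow_le_sub hs.le hm0
        _ = _ := by push_cast; ring
  refine le_of_tendsto (tendsto_const_nhds.sub hL).norm
    ((eventually_ge_atTop n).mono fun m hm => ?_)
  rw [Real.norm_of_nonneg (by positivity)]
  exact (norm_sub_le hm).trans (by gcongr; exact sub_le_self _ (by positivity))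

theorem natCast_mul_coeff_expandAtOne_negLogSeries (γ : ℂ) (N n : ℕ) :
    n * coeff n (expandAtOne γ (negLogSeries γ) (N + 1)) =
      γ * coeff n (expandAtOne (γ + 1) (negLogSeries (γ + 1)) (N + 1)) -
        (γ - N) * coeff N (negLogSeries γ) * coeff n (oneSubCPow (γ - N)) := by
  have step (k : ℕ) := natCast_mul_coeff_oneSubCPow (γ - k) n
  simp only [coeff_expandAtOne]
  induction N with
  | zero =>
    have h := step 0
    simp [coeff_zero_negLogSeries] at h ⊢
    linear_combination h
  | succ N ih =>
    have h := step (N + 1)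
    have hγ : γ - (N + 1 : ℕ) + 1 = γ - N := by push_cast; ring
    have hγ' : γ + 1 - (N + 1 : ℕ) = γ - N := by push_cast; ring
    rw [Finset.sum_range_succ, mul_add, ih, Finset.sum_range_succ _ (N + 1), mul_add, hγ']
    rw [hγ] at h
    push_cast at h ⊢
    linear_combination coeff (N + 1) (negLogSeries γ) * h -
      coeff n (oneSubCPow (γ - N)) * mul_coeff_negLogSeries_add_one γ N

theorem isBigO_mul_coeff_expandAtOne_sub (γ : ℂ) (N : ℕ) :
    (fun n : ℕ => n * coeff n (expandAtOne (γ - 1) (negLogSeries (γ - 1)) N) -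
      (γ - 1) * coeff n (expandAtOne γ (negLogSeries γ) N)) =O[atTop]
        fun n : ℕ => (n : ℝ) ^ (γ.re - 1 - N) := by
  rcases N with _ | N
  · simpa [expandAtOne] using isBigO_zero _ _
  · have h (n : ℕ) := natCast_mul_coeff_expandAtOne_negLogSeries (γ - 1) N n
    simp only [sub_add_cancel] at h
    simp only [h, sub_sub_cancel_left]
    refine (((hasCoeffBound_oneSubCPow _).mono ?_).const_mul_left _).neg_left
    simp
    linarith

theorem isBigO_pow_mul_coeff_expandAtOne_sub (γ : ℂ) (N j : ℕ) :
    (fun n : ℕ => n ^ j * coeff n (expandAtOne (γ - j) (negLogSeries (γ - j)) N) -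
      (descPochhammer ℤ j).smeval (γ - 1) * coeff n (expandAtOne γ (negLogSeries γ) N)) =O[atTop]
        fun n : ℕ => (n : ℝ) ^ (γ.re - 1 - N) := by
  induction j with
  | zero => simpa using isBigO_zero _ _
  | succ j ih =>
    have hpow : (fun n : ℕ => (n : ℂ) ^ j) =O[atTop] fun n : ℕ => (n : ℝ) ^ (j : ℝ) :=
      .of_bound' (.of_forall fun n => by simp)
    refine ((hpow.mul (isBigO_mul_coeff_expandAtOne_sub (γ - j) N)).trans_eventuallyEq ?_
      |>.add (ih.const_mul_left (γ - 1 - j))).congr_left fun n => ?_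
    · filter_upwards [eventually_gt_atTop 0] with n hn
      rw [← Real.rpow_add (by exact_mod_cast hn), Complex.sub_re, Complex.natCast_re]
      ring_nf
    · rw [descPochhammer_succ_right, Polynomial.smeval_mul, Polynomial.smeval_sub,
        Polynomial.smeval_X, Polynomial.smeval_natCast, Nat.cast_succ, ← sub_sub γ]
      simp only [pow_one, pow_zero, nsmul_one]
      ring

theorem X_pow_dvd_sub_trunc (S : ℂ⟦X⟧) (N : ℕ) : X ^ N ∣ S - (trunc N S : ℂ⟦X⟧) := by
  rw [X_pow_dvd_iff]
  intro m hm
  rw [map_sub, Polynomial.coeff_coe, coeff_trunc, if_pos hm, sub_self]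

theorem X_pow_dvd_one_sub_X_mul_sum_trunc_negLogSeries_sub (γ : ℂ) (N : ℕ) :
    Polynomial.X ^ (N + 1) ∣ (1 - Polynomial.X) * ∑ j ∈ Finset.range (N + 1),
      Polynomial.C ((j.factorial : ℂ)⁻¹) *
        (Polynomial.X ^ j * trunc (N + 1) (negLogSeries (γ - j))) -
      trunc (N + 1) (negLogSeries γ) := by
  have dvd_of_coe {q : Polynomial ℂ} (h : X ^ (N + 1) ∣ (q : ℂ⟦X⟧)) :
      Polynomial.X ^ (N + 1) ∣ q := by
    simpa only [Polynomial.X_pow_dvd_iff, X_pow_dvd_iff, Polynomial.coeff_coe] using h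
  have untruncated : X ^ (N + 1) ∣ (1 - X) * ∑ j ∈ Finset.range (N + 1),
      C ((j.factorial : ℂ)⁻¹) * (X ^ j * negLogSeries (γ - j)) - negLogSeries γ := by
    convert (X_pow_dvd_one_sub_X_mul_sum_negLogSeries N).mul_left (negLogSeries γ) using 1
    rw [mul_sub, mul_left_comm, Finset.mul_sum _ _ (negLogSeries γ), mul_one]
    congr 2
    refine Finset.sum_congr rfl fun j _ => ?_
    rw [sub_eq_add_neg γ, negLogSeries_add]
    ring
  refine dvd_of_coe ?_
  rw [← Polynomial.coeToPowerSeries.ringHom_apply]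
  simp only [map_sub, map_mul, map_sum, map_one, map_pow]
  simp only [Polynomial.coeToPowerSeries.ringHom_apply, Polynomial.coe_C, Polynomial.coe_X]
  have truncation := dvd_sub ((Finset.dvd_sum fun j (_ : j ∈ Finset.range (N + 1)) =>
    ((X_pow_dvd_sub_trunc (negLogSeries (γ - j)) (N + 1)).mul_left (X ^ j)).mul_left
      (C ((j.factorial : ℂ)⁻¹))).mul_left (1 - X)) (X_pow_dvd_sub_trunc (negLogSeries γ) (N + 1))
  convert untruncated.sub truncation using 1
  simp only [mul_sub, Finset.sum_sub_distrib]
  ring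

theorem isBigO_coeff_succ_expandAtOne_sub_sum (γ : ℂ) (N : ℕ) :
    (fun n : ℕ => coeff (n + 1) (expandAtOne γ (negLogSeries γ) (N + 1)) -
      ∑ j ∈ Finset.range (N + 1), (j.factorial : ℂ)⁻¹ *
        coeff n (expandAtOne (γ - j) (negLogSeries (γ - j)) (N + 1))) =O[atTop]
          fun n : ℕ => (n : ℝ) ^ (γ.re - 1 - (N + 1)) := by
  have h := hasCoeffBound_oneSubCPow_mul_aeval γ
    (X_pow_dvd_one_sub_X_mul_sum_trunc_negLogSeries_sub γ N)
  have h_eq : oneSubCPow γ * Polynomial.aeval (1 - X : ℂ⟦X⟧)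
      ((1 - Polynomial.X) * ∑ j ∈ Finset.range (N + 1), Polynomial.C ((j.factorial : ℂ)⁻¹) *
        (Polynomial.X ^ j * trunc (N + 1) (negLogSeries (γ - j))) -
          trunc (N + 1) (negLogSeries γ)) =
      X * ∑ j ∈ Finset.range (N + 1), C ((j.factorial : ℂ)⁻¹) *
        expandAtOne (γ - j) (negLogSeries (γ - j)) (N + 1) -
          expandAtOne γ (negLogSeries γ) (N + 1) := by
    simp only [expandAtOne_eq_mul_aeval, map_sub, map_mul, map_sum, map_pow, map_one,
      Polynomial.aeval_X, Polynomial.aeval_C, oneSubCPow_sub_natCast, mul_sub, sub_sub_cancel,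
      Finset.mul_sum, PowerSeries.algebraMap_apply, Algebra.algebraMap_self_apply]
    congr! 2 with j
    ring
  rw [h_eq] at h
  have h_succ := (h.comp_tendsto (tendsto_add_atTop_nat 1)).neg_left
  simp only [Function.comp_def, Nat.cast_add_one] at h_succ
  refine (h_succ.trans_isTheta (isTheta_natCast_add_one_rpow _)).congr_left fun n => ?_
  simp only [map_sub, coeff_succ_X_mul, map_sum, coeff_C_mul, neg_sub]

theorem isBigO_one_add_inv_cpow_sub_sum (s : ℂ) (N : ℕ) :
    (fun n : ℕ => (1 + (n : ℂ)⁻¹) ^ s -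
      ∑ j ∈ Finset.range N, (j.factorial : ℂ)⁻¹ * (descPochhammer ℤ j).smeval s * (n : ℂ)⁻¹ ^ j)
        =O[atTop] fun n : ℕ => (n : ℝ) ^ (-N : ℝ) := by
  have htaylor := Complex.one_add_cpow_hasFPowerSeriesAt_zero (a := s)
    |>.isBigO_sub_partialSum_pow N
  refine ((htaylor.comp_tendsto tendsto_inv_atTop_nhds_zero_nat).congr_right fun n => ?_).congr_left
    fun n => ?_
  · simp [Real.rpow_neg]
  · simp [FormalMultilinearSeries.partialSum, _root_.binomialSeries, Ring.choose_eq_smul,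
      mul_comm]

theorem isBigO_coeff_succ_expandAtOne_sub_mul (γ : ℂ) (N : ℕ) :
    (fun n : ℕ => coeff (n + 1) (expandAtOne γ (negLogSeries γ) (N + 1)) -
      (1 + (n : ℂ)⁻¹) ^ (γ - 1) * coeff n (expandAtOne γ (negLogSeries γ) (N + 1))) =O[atTop]
        fun n : ℕ => (n : ℝ) ^ (γ.re - 1 - (N + 1)) := by
  have inv_pow (j : ℕ) : (fun n : ℕ => (n : ℂ)⁻¹ ^ j) =O[atTop] fun _ => (1 : ℝ) :=
    ((tendsto_inv_atTop_nhds_zero_nat (𝕜 := ℂ)).pow j).isBigO_one ℝ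
  have lower_terms := IsBigO.fun_sum fun j (_ : j ∈ Finset.range (N + 1)) =>
    ((inv_pow j).mul (isBigO_pow_mul_coeff_expandAtOne_sub γ (N + 1) j)).const_mul_left
      (j.factorial : ℂ)⁻¹
  have binomial := (isBigO_one_add_inv_cpow_sub_sum (γ - 1) (N + 1)).mul
    (hasCoeffBound_expandAtOne γ (negLogSeries γ) (N + 1))
  simp only [one_mul, Nat.cast_add_one] at lower_terms binomial
  refine (((isBigO_coeff_succ_expandAtOne_sub_sum γ N).add lower_terms).sub
    (binomial.trans_eventuallyEq ?_)).congr' ?_ .rfl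
  · filter_upwards [eventually_gt_atTop 0] with n hn
    rw [← Real.rpow_add (by exact_mod_cast hn), neg_add_eq_sub]
  · filter_upwards [eventually_gt_atTop 0] with n hn
    have hn0 : (n : ℂ) ≠ 0 := by exact_mod_cast hn.ne'
    have cancel (j : ℕ) (z : ℂ) : (n : ℂ)⁻¹ ^ j * (n ^ j * z) = z := by
      rw [← mul_assoc, ← mul_pow, inv_mul_cancel₀ hn0, one_pow, one_mul]
    simp only [mul_sub, sub_mul, cancel, Finset.sum_sub_distrib, Finset.sum_mul]
    have swap (j : ℕ) (d v : ℂ) : (j.factorial : ℂ)⁻¹ * ((n : ℂ)⁻¹ ^ j * (d * v)) =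
        (j.factorial : ℂ)⁻¹ * d * (n : ℂ)⁻¹ ^ j * v := by ring
    simp only [swap]
    ring

theorem tendsto_coeff_expandAtOne_negLogSeries_mul (γ : ℂ) (N : ℕ) :
    Tendsto (fun n : ℕ => coeff n (expandAtOne γ (negLogSeries γ) (N + 1)) * (n : ℂ) ^ (1 - γ))
      atTop (𝓝 (Complex.Gamma γ)⁻¹) := by
  have leading : expandAtOne γ (negLogSeries γ) 1 = oneSubCPow γ := by
    simp [expandAtOne, coeff_zero_negLogSeries]
  have rest := hasCoeffBound_expandAtOne_sub_expandAtOne γ (negLogSeries γ) (Nat.le_add_left 1 N)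
  rw [leading] at rest
  have rest_isBigO : (fun n : ℕ => coeff n (expandAtOne γ (negLogSeries γ) (N + 1) -
      oneSubCPow γ) * (n : ℂ) ^ (1 - γ)) =O[atTop] fun n : ℕ => ((n : ℝ))⁻¹ := by
    refine (IsBigO.mul rest (isTheta_natCast_cpow (1 - γ)).isBigO).trans_eventuallyEq ?_
    filter_upwards [eventually_gt_atTop 0] with n hn
    rw [← Real.rpow_add (by exact_mod_cast hn), ← Real.rpow_neg_one, Complex.sub_re, Complex.one_re,
      Nat.cast_one]
    ring_nf
  have h := (rest_isBigO.trans_tendsto tendsto_inv_atTop_nhds_zero_nat).add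
    (tendsto_coeff_oneSubCPow γ)
  simpa only [← add_mul, map_sub, sub_add_cancel, zero_add] using h

/-- The power series with coefficients `n ^ (γ - 1) / Γ(γ)`. -/
noncomputable def powSeries (γ : ℂ) : ℂ⟦X⟧ :=
  .mk fun n => (n : ℂ) ^ (γ - 1) / Complex.Gamma γ

theorem one_add_inv_cpow_mul_add_one_cpow (s : ℂ) {n : ℕ} (hn : 0 < n) :
    (1 + (n : ℂ)⁻¹) ^ s * ((n + 1 : ℕ) : ℂ) ^ (-s) = (n : ℂ) ^ (-s) := by
  have hn0 : (n : ℂ) ≠ 0 := by exact_mod_cast hn.ne'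
  have h : ((n + 1 : ℕ) : ℂ) = ((1 + (n : ℝ)⁻¹ : ℝ) : ℂ) * ((n : ℝ) : ℂ) := by
    push_cast
    field_simp
  have hbase : (1 + (n : ℂ)⁻¹) = ((1 + (n : ℝ)⁻¹ : ℝ) : ℂ) := by push_cast; rfl
  have hbase0 : ((1 + (n : ℝ)⁻¹ : ℝ) : ℂ) ≠ 0 := by
    rw [Complex.ofReal_ne_zero]
    positivity
  rw [h, Complex.mul_cpow_ofReal_nonneg (by positivity) (by positivity), hbase, ← mul_assoc,
    ← Complex.cpow_add _ _ hbase0, add_neg_cancel, Complex.cpow_zero, one_mul,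
    Complex.ofReal_natCast]

theorem isBigO_succ_sub_coeff_expandAtOne_mul_cpow (γ : ℂ) (N : ℕ) :
    (fun n : ℕ => coeff (n + 1) (expandAtOne γ (negLogSeries γ) (N + 1)) *
        ((n + 1 : ℕ) : ℂ) ^ (1 - γ) -
      coeff n (expandAtOne γ (negLogSeries γ) (N + 1)) * (n : ℂ) ^ (1 - γ)) =O[atTop]
        fun n : ℕ => (n : ℝ) ^ (-N - 1 : ℝ) := by
  have hpow := (isTheta_natCast_cpow (1 - γ)).isBigO.comp_tendsto (tendsto_add_atTop_nat 1)
  simp only [Function.comp_def, Nat.cast_add_one] at hpow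
  refine ((isBigO_coeff_succ_expandAtOne_sub_mul γ N).mul
    (hpow.trans_isTheta (isTheta_natCast_add_one_rpow _))).congr' ?_ ?_
  · filter_upwards [eventually_gt_atTop 0] with n hn
    have h := one_add_inv_cpow_mul_add_one_cpow (γ - 1) hn
    rw [neg_sub] at h
    rw [← h]
    push_cast
    ring
  · filter_upwards [eventually_gt_atTop 0] with n hn
    rw [← Real.rpow_add (by exact_mod_cast hn), Complex.sub_re, Complex.one_re]
    ring_nf

-- The ratio of consecutive coefficients of the expansion is `(1 + 1 / n) ^ (γ - 1)` to high order,
-- so that their products with `n ^ (1 - γ)` converge fast to their limit `1 / Γ(γ)`.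
theorem hasCoeffBound_powSeries_sub_expandAtOne (γ : ℂ) (N : ℕ) :
    HasCoeffBound (powSeries γ - expandAtOne γ (negLogSeries γ) N) (γ.re - 1 - N) := by
  have limit := isBigO_sub_of_isBigO_succ_sub (by positivity)
    (isBigO_succ_sub_coeff_expandAtOne_mul_cpow γ (N + 1))
    (tendsto_coeff_expandAtOne_negLogSeries_mul γ (N + 1))
  have two_more : HasCoeffBound (powSeries γ - expandAtOne γ (negLogSeries γ) (N + 1 + 1))
      (γ.re - 1 - (N + 1)) := by
    refine (limit.mul (isTheta_natCast_cpow (γ - 1)).isBigO).neg_left.congr' ?_ ?_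
    · filter_upwards [eventually_gt_atTop 0] with n hn
      have hn0 : (n : ℂ) ≠ 0 := by exact_mod_cast hn.ne'
      rw [sub_mul, mul_assoc, ← Complex.cpow_add _ _ hn0, sub_add_sub_cancel, sub_self,
        Complex.cpow_zero, mul_one, neg_sub, map_sub, powSeries, coeff_mk, div_eq_inv_mul]
    · filter_upwards [eventually_gt_atTop 0] with n hn
      rw [← Real.rpow_add (by exact_mod_cast hn), Complex.sub_re, Complex.one_re]
      push_cast
      ring_nf
  rw [← sub_add_sub_cancel _ (expandAtOne γ (negLogSeries γ) (N + 1 + 1))]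
  exact (two_more.mono (by linarith)).add
    (hasCoeffBound_expandAtOne_sub_expandAtOne _ _ (by omega))

/-! ### Toeplitz operators with smooth symbol -/

open scoped ContDiff in
/-- Real smoothness at every point of the unit circle. -/
def SmoothOnCircle (φ : ℂ → ℂ) : Prop :=
  ∀ z, ‖z‖ = 1 → ContDiffAt ℝ ∞ φ z

theorem SmoothOnCircle.continuousOn {φ : ℂ → ℂ} (hφ : SmoothOnCircle φ) :
    ContinuousOn φ (Metric.sphere 0 1) := fun z hz =>
  (hφ z (mem_sphere_zero_iff_norm.1 hz)).continuousAt.continuousWithinAt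

/-- The `k`-th Fourier coefficient of the restriction of `φ` to the unit circle. -/
noncomputable def circleCoeff (φ : ℂ → ℂ) (k : ℤ) : ℂ :=
  Real.circleAverage (fun z => φ z * z ^ (-k)) 0 1

theorem circleIntegrable_mul_zpow {φ : ℂ → ℂ}
    (hφ : ContinuousOn φ (Metric.sphere 0 1)) (k : ℤ) :
    CircleIntegrable (fun z => φ z * z ^ k) 0 1 :=
  ContinuousOn.circleIntegrable zero_le_one (hφ.mul (continuousOn_id.zpow₀ k fun z hz =>
    .inl (norm_ne_zero_iff.1 (by simp_all))))

theorem norm_circleAverage_le {F : ℂ → ℂ} {B : ℝ} (hF : ∀ z, ‖z‖ = 1 → ‖F z‖ ≤ B) :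
    ‖Real.circleAverage F 0 1‖ ≤ B := by
  rw [Real.circleAverage_def, norm_smul, Real.norm_of_nonneg (by positivity)]
  have h := intervalIntegral.norm_integral_le_of_norm_le_const (a := 0) (b := 2 * Real.pi)
    (f := fun θ => F (circleMap 0 1 θ)) (C := B) fun θ _ => hF _ (by simp)
  rw [sub_zero, abs_of_pos Real.two_pi_pos] at h
  rwa [inv_mul_le_iff₀ Real.two_pi_pos, mul_comm _ B]

theorem circleCoeff_sub {φ ψ : ℂ → ℂ} (hφ : ContinuousOn φ (Metric.sphere 0 1))
    (hψ : ContinuousOn ψ (Metric.sphere 0 1)) (k : ℤ) :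
    circleCoeff (fun z => φ z - ψ z) k = circleCoeff φ k - circleCoeff ψ k := by
  simp only [circleCoeff, sub_mul]
  exact Real.circleAverage_fun_sub (circleIntegrable_mul_zpow hφ _)
    (circleIntegrable_mul_zpow hψ _)

theorem circleCoeff_congr {φ ψ : ℂ → ℂ} (h : ∀ z, ‖z‖ = 1 → φ z = ψ z) (k : ℤ) :
    circleCoeff φ k = circleCoeff ψ k :=
  Real.circleAverage_congr_sphere fun z hz => by
    simp only [h z (by simpa using hz)]

theorem circleCoeff_id_mul (φ : ℂ → ℂ) (k : ℤ) :
    circleCoeff (fun z => z * φ z) k = circleCoeff φ (k - 1) :=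
  Real.circleAverage_congr_sphere fun z hz => by
    have hz0 : z ≠ 0 := norm_ne_zero_iff.1 (by simp_all)
    beta_reduce
    rw [neg_sub, sub_eq_add_neg, zpow_add₀ hz0, zpow_one]
    ring

theorem SmoothOnCircle.fderiv {φ : ℂ → ℂ} (hφ : SmoothOnCircle φ) :
    SmoothOnCircle fun z => fderiv ℝ φ z (z * Complex.I) := fun z hz =>
  ((hφ z hz).fderiv_right (by simp)).clm_apply (by fun_prop)

theorem circleCoeff_fderiv {φ : ℂ → ℂ} (hφ : SmoothOnCircle φ) (k : ℤ) :
    circleCoeff (fun z => fderiv ℝ φ z (z * Complex.I)) k = Complex.I * k * circleCoeff φ k := by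
  have hderiv (θ : ℝ) : HasDerivAt (fun θ : ℝ => φ (circleMap 0 1 θ) * circleMap 0 1 θ ^ (-k))
      (fderiv ℝ φ (circleMap 0 1 θ) (circleMap 0 1 θ * Complex.I) * circleMap 0 1 θ ^ (-k) -
        Complex.I * k * (φ (circleMap 0 1 θ) * circleMap 0 1 θ ^ (-k))) θ := by
    have hz0 : circleMap 0 1 θ ≠ 0 := circleMap_ne_center one_ne_zero
    have h := ((hφ _ (by simp)).differentiableAt (by simp)).hasFDerivAt.comp_hasDerivAt θ
      (hasDerivAt_circleMap 0 1 θ)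
    refine (h.mul ((hasDerivAt_zpow (-k) _ (.inl hz0)).scomp θ
      (hasDerivAt_circleMap 0 1 θ))).congr_deriv ?_
    simp only [Function.comp_apply, smul_eq_mul, zpow_sub_one₀ hz0]
    field_simp
    push_cast
    ring
  have hint := circleIntegrable_mul_zpow hφ.fderiv.continuousOn (-k)
  have hint' := (circleIntegrable_mul_zpow hφ.continuousOn (-k)).const_fun_smul
    (a := Complex.I * k)
  have h := intervalIntegral.integral_eq_sub_of_hasDerivAt (fun θ _ => hderiv θ)
    (hint.sub hint' : IntervalIntegrable _ volume 0 (2 * Real.pi))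
  have hper : circleMap 0 1 (2 * Real.pi) = circleMap 0 1 0 := by
    simpa using periodic_circleMap 0 1 0
  rw [hper, sub_self] at h
  have heq := sub_eq_zero.1 ((intervalIntegral.integral_sub hint hint').symm.trans h)
  calc circleCoeff (fun z => fderiv ℝ φ z (z * Complex.I)) k
      = Real.circleAverage (fun z => (Complex.I * k) • (φ z * z ^ (-k))) 0 1 :=
        congrArg ((2 * Real.pi)⁻¹ • ·) heq
    _ = Complex.I * k * circleCoeff φ k := Real.circleAverage_fun_smul

theorem exists_norm_circleCoeff_le {φ : ℂ → ℂ} (hφ : SmoothOnCircle φ) (M : ℕ) :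
    ∃ C : ℝ, 0 ≤ C ∧ ∀ k : ℤ, ‖circleCoeff φ k‖ ≤ C * (1 + |(k : ℝ)|) ^ (-(M : ℝ)) := by
  induction M generalizing φ with
  | zero =>
    obtain ⟨B, hB⟩ := (isCompact_sphere (0 : ℂ) 1).exists_bound_of_continuousOn hφ.continuousOn
    refine ⟨B, (norm_nonneg _).trans (hB 1 (by simp)), fun k => ?_⟩
    rw [Nat.cast_zero, neg_zero, Real.rpow_zero, mul_one]
    exact norm_circleAverage_le fun z hz => by
      simpa [norm_zpow, hz] using hB z (by simpa using hz)
  | succ M ih =>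
    obtain ⟨C, hC0, hC⟩ := ih hφ
    obtain ⟨D, hD0, hD⟩ := ih hφ.fderiv
    refine ⟨C + D, by positivity, fun k => ?_⟩
    have hk : (0 : ℝ) < 1 + |(k : ℝ)| := by positivity
    have hDk : |(k : ℝ)| * ‖circleCoeff φ k‖ ≤ D * (1 + |(k : ℝ)|) ^ (-(M : ℝ)) := by
      simpa [circleCoeff_fderiv hφ] using hD k
    have h : (1 + |(k : ℝ)|) * ‖circleCoeff φ k‖ ≤ (C + D) * (1 + |(k : ℝ)|) ^ (-(M : ℝ)) := by
      linarith [hC k]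
    rw [Nat.cast_succ, neg_add, ← sub_eq_add_neg, Real.rpow_sub_one hk.ne', mul_div_assoc',
      le_div_iff₀ hk]
    linarith

/-- The Toeplitz operator with symbol `φ`: the nonnegative Fourier modes of the product of `φ` with
the boundary distribution `∑ fₖ zᵏ` on the unit circle. -/
noncomputable def toeplitz (φ : ℂ → ℂ) (f : ℂ⟦X⟧) : ℂ⟦X⟧ :=
  .mk fun n => ∑' k : ℕ, coeff k f * circleCoeff φ (n - k)

theorem coeff_toeplitz (φ : ℂ → ℂ) (f : ℂ⟦X⟧) (n : ℕ) :
    coeff n (toeplitz φ f) = ∑' k : ℕ, coeff k f * circleCoeff φ (n - k) :=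
  coeff_mk ..

theorem toeplitz_congr {φ ψ : ℂ → ℂ} (h : ∀ z, ‖z‖ = 1 → φ z = ψ z) (f : ℂ⟦X⟧) :
    toeplitz φ f = toeplitz ψ f := by
  simp only [toeplitz, circleCoeff_congr h]

theorem summable_one_add_abs_int_rpow {s : ℝ} (hs : s < -1) :
    Summable fun k : ℤ => (1 + |(k : ℝ)|) ^ s := by
  have h := summable_nat_add_one_rpow hs
  exact .of_nat_of_neg (by simpa [add_comm] using h) (by simpa [add_comm] using h)

namespace HasCoeffBound

variable {f : ℂ⟦X⟧} {a : ℝ} {φ : ℂ → ℂ}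

theorem exists_norm_mul_circleCoeff_le (hf : HasCoeffBound f a) (hφ : SmoothOnCircle φ) :
    ∃ C : ℝ, 0 ≤ C ∧ ∀ n k : ℕ, ‖coeff k f * circleCoeff φ (n - k)‖ ≤
      C * ((n : ℝ) + 1) ^ a * (1 + |((n - k : ℤ) : ℝ)|) ^ (-2 : ℝ) := by
  obtain ⟨C, hC0, hC⟩ := hf.exists_nonneg
  obtain ⟨M, hM⟩ := exists_nat_ge (|a| + 2)
  obtain ⟨D, hD0, hD⟩ := exists_norm_circleCoeff_le hφ M
  refine ⟨C * D, by positivity, fun n k => ?_⟩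
  have h1 : (1 : ℝ) ≤ 1 + |((n - k : ℤ) : ℝ)| := by simp
  have hk : ((k : ℝ) + 1) ^ a ≤ ((n : ℝ) + 1) ^ a * (1 + |((n - k : ℤ) : ℝ)|) ^ |a| := by
    simpa [abs_sub_comm] using add_one_rpow_le_mul k.cast_nonneg (n.cast_nonneg : (0 : ℝ) ≤ n) a
  calc ‖coeff k f * circleCoeff φ (n - k)‖
      ≤ (C * (((n : ℝ) + 1) ^ a * (1 + |((n - k : ℤ) : ℝ)|) ^ |a|)) *
          (D * (1 + |((n - k : ℤ) : ℝ)|) ^ (-(M : ℝ))) := by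
        rw [norm_mul]
        gcongr
        exacts [(hC k).trans (by gcongr), hD _]
    _ = C * D * ((n : ℝ) + 1) ^ a * (1 + |((n - k : ℤ) : ℝ)|) ^ (|a| - M) := by
        rw [sub_eq_add_neg |a|, Real.rpow_add (by positivity)]
        ring
    _ ≤ _ := by gcongr; linarith

theorem summable_mul_circleCoeff (hf : HasCoeffBound f a) (hφ : SmoothOnCircle φ) (n : ℕ) :
    Summable fun k : ℕ => ‖coeff k f * circleCoeff φ (n - k)‖ := by
  obtain ⟨C, -, hC⟩ := hf.exists_norm_mul_circleCoeff_le hφ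
  refine .of_nonneg_of_le (fun _ => norm_nonneg _) (hC n) (.mul_left _ ?_)
  exact (summable_one_add_abs_int_rpow (by norm_num)).comp_injective
    (i := fun k : ℕ => (n - k : ℤ)) fun _ _ h => by simpa using h

end HasCoeffBound

theorem hasCoeffBound_toeplitz {f : ℂ⟦X⟧} {a : ℝ} {φ : ℂ → ℂ} (hf : HasCoeffBound f a)
    (hφ : SmoothOnCircle φ) :
    HasCoeffBound (toeplitz φ f) a := by
  obtain ⟨C, hC0, hC⟩ := hf.exists_norm_mul_circleCoeff_le hφ
  have hs := summable_one_add_abs_int_rpow (s := -2) (by norm_num)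
  refine HasCoeffBound.iff_exists.2 ⟨C * ∑' j : ℤ, (1 + |(j : ℝ)|) ^ (-2 : ℝ), fun n => ?_⟩
  have inj : Function.Injective fun k : ℕ => (n - k : ℤ) := fun _ _ h => by simpa using h
  have hsn := (hs.comp_injective inj).mul_left (C * ((n : ℝ) + 1) ^ a)
  calc ‖coeff n (toeplitz φ f)‖
      ≤ ∑' k : ℕ, C * ((n : ℝ) + 1) ^ a * (1 + |((n - k : ℤ) : ℝ)|) ^ (-2 : ℝ) := by
        rw [coeff_toeplitz]
        exact tsum_of_norm_bounded hsn.hasSum (hC n)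
    _ = C * ((n : ℝ) + 1) ^ a * ∑' k : ℕ, (1 + |((n - k : ℤ) : ℝ)|) ^ (-2 : ℝ) := tsum_mul_left
    _ ≤ C * ((n : ℝ) + 1) ^ a * ∑' j : ℤ, (1 + |(j : ℝ)|) ^ (-2 : ℝ) := by
        gcongr
        exact tsum_comp_le_tsum_of_inj hs (fun _ => by positivity) inj
    _ = _ := by ring

theorem toeplitz_sub_left {φ ψ : ℂ → ℂ} {f : ℂ⟦X⟧} {a : ℝ} (hf : HasCoeffBound f a)
    (hφ : SmoothOnCircle φ) (hψ : SmoothOnCircle ψ) :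
    toeplitz (fun z => φ z - ψ z) f = toeplitz φ f - toeplitz ψ f := by
  ext n
  simp only [map_sub, coeff_toeplitz, circleCoeff_sub hφ.continuousOn hψ.continuousOn, mul_sub]
  exact (hf.summable_mul_circleCoeff hφ n).of_norm.tsum_sub
    (hf.summable_mul_circleCoeff hψ n).of_norm

theorem toeplitz_sub_right {φ : ℂ → ℂ} {f g : ℂ⟦X⟧} {a b : ℝ} (hf : HasCoeffBound f a)
    (hg : HasCoeffBound g b) (hφ : SmoothOnCircle φ) :
    toeplitz φ (f - g) = toeplitz φ f - toeplitz φ g := by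
  ext n
  simp only [map_sub, coeff_toeplitz, sub_mul]
  exact (hf.summable_mul_circleCoeff hφ n).of_norm.tsum_sub
    (hg.summable_mul_circleCoeff hφ n).of_norm

theorem toeplitz_X_mul (φ : ℂ → ℂ) (f : ℂ⟦X⟧) :
    toeplitz φ (X * f) = toeplitz (fun z => z * φ z) f := by
  ext n
  have h : Function.support (fun k : ℕ => coeff k (X * f) * circleCoeff φ (n - k)) ⊆
      Set.range Nat.succ := fun k hk => by
    rcases k with _ | k
    · simp at hk
    · exact ⟨k, rfl⟩
  rw [coeff_toeplitz, coeff_toeplitz, ← Nat.succ_injective.tsum_eq h]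
  refine tsum_congr fun k => ?_
  rw [circleCoeff_id_mul, Nat.succ_eq_add_one, coeff_succ_X_mul, Nat.cast_succ, sub_sub]

theorem toeplitz_one_sub_X_mul {φ : ℂ → ℂ} {f : ℂ⟦X⟧} {a : ℝ} (hf : HasCoeffBound f a)
    (hφ : SmoothOnCircle φ) :
    toeplitz φ ((1 - X) * f) = toeplitz (fun z => (1 - z) * φ z) f := by
  have hXf : HasCoeffBound (X * f) a := by
    convert hf.sub (hf.mul_one_sub_X_pow 1) using 1
    ring
  have hzφ : SmoothOnCircle fun z => z * φ z := fun z hz => contDiffAt_id.mul (hφ z hz)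
  simp only [sub_mul, one_mul]
  rw [toeplitz_sub_right hf hXf hφ, toeplitz_X_mul, toeplitz_sub_left hf hφ hzφ]

theorem toeplitz_one_sub_X_pow_mul {φ : ℂ → ℂ} {f : ℂ⟦X⟧} {a : ℝ} (hf : HasCoeffBound f a)
    (hφ : SmoothOnCircle φ) (M : ℕ) :
    toeplitz φ ((1 - X) ^ M * f) = toeplitz (fun z => (1 - z) ^ M * φ z) f := by
  induction M generalizing φ with
  | zero => simp only [pow_zero, one_mul]
  | succ M ih =>
    have hf' : HasCoeffBound ((1 - X) ^ M * f) a := mul_comm f _ ▸ hf.mul_one_sub_X_pow M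
    rw [pow_succ', mul_assoc, toeplitz_one_sub_X_mul hf' hφ,
      ih fun z hz => .mul (by fun_prop) (hφ z hz)]
    simp only [pow_succ, mul_assoc]

theorem circleCoeff_one (k : ℤ) : circleCoeff 1 k = if k = 0 then 1 else 0 := by
  split_ifs with hk
  · simp only [circleCoeff, hk, neg_zero, zpow_zero, mul_one]
    exact Real.circleAverage_const 1 0 1
  · have h := circleCoeff_fderiv (φ := 1) (fun z _ => contDiffAt_const) k
    have h0 : circleCoeff (fun _ => 0) k = 0 := by simp [circleCoeff, Real.circleAverage_def]
    have e : (fun z : ℂ => fderiv ℝ (1 : ℂ → ℂ) z (z * Complex.I)) = fun _ => 0 := by ext; simp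
    rw [e, h0, eq_comm] at h
    exact (mul_eq_zero.1 h).resolve_left (mul_ne_zero Complex.I_ne_zero (Int.cast_ne_zero.2 hk))

theorem toeplitz_one (f : ℂ⟦X⟧) : toeplitz 1 f = f := by
  ext n
  rw [coeff_toeplitz, tsum_eq_single n fun k hk => ?_]
  · simp [circleCoeff_one]
  · rw [circleCoeff_one, if_neg (sub_ne_zero.2 (Nat.cast_injective.ne hk.symm)), mul_zero]

/-! ### Localisation at the singularity -/

theorem hasSum_circleAverage {F : ℕ → ℂ → ℂ} {u : ℕ → ℝ} (hF : ∀ k, CircleIntegrable (F k) 0 1)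
    (hu : Summable u) (hFu : ∀ k z, ‖z‖ = 1 → ‖F k z‖ ≤ u k) :
    HasSum (fun k => Real.circleAverage (F k) 0 1)
      (Real.circleAverage (fun z => ∑' k, F k z) 0 1) :=
  (intervalIntegral.hasSum_integral_of_dominated_convergence (fun k _ => u k)
    (fun k => ((hF k).def' : IntegrableOn _ _ _).aestronglyMeasurable)
    (fun k => .of_forall fun _ _ => hFu k _ (by simp)) (.of_forall fun _ _ => hu) (by simp)
    (.of_forall fun _ _ =>
      (Summable.of_norm_bounded hu fun k => hFu k _ (by simp)).hasSum)).const_smul _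

theorem coeff_toeplitz_eq_circleAverage {φ : ℂ → ℂ} {f : ℂ⟦X⟧}
    (hφ : ContinuousOn φ (Metric.sphere 0 1)) (hf : Summable fun k : ℕ => ‖coeff k f‖) (n : ℕ) :
    coeff n (toeplitz φ f) =
      Real.circleAverage (fun z => (∑' k : ℕ, coeff k f * z ^ k) * (φ z * z ^ (-n : ℤ))) 0 1 := by
  obtain ⟨B, hB⟩ := (isCompact_sphere (0 : ℂ) 1).exists_bound_of_continuousOn hφ
  have hint (k : ℕ) : CircleIntegrable (fun z => coeff k f * z ^ k * (φ z * z ^ (-n : ℤ))) 0 1 := by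
    have hφk : ContinuousOn (fun z => coeff k f * z ^ k * φ z) (Metric.sphere 0 1) := by fun_prop
    simpa only [mul_assoc] using circleIntegrable_mul_zpow hφk (-n)
  have havg (k : ℕ) : Real.circleAverage (fun z => coeff k f * z ^ k * (φ z * z ^ (-n : ℤ))) 0 1 =
      coeff k f * circleCoeff φ (n - k) := by
    rw [circleCoeff, ← smul_eq_mul (coeff k f), ← Real.circleAverage_fun_smul]
    refine Real.circleAverage_congr_sphere fun z hz => ?_
    have hz0 : z ≠ 0 := norm_ne_zero_iff.1 (by simp_all)
    rw [neg_sub, sub_eq_add_neg, zpow_add₀ hz0, zpow_natCast, smul_eq_mul]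
    ring
  have h := hasSum_circleAverage hint (hf.mul_right B) fun k z hz => by
    simpa [hz] using mul_le_mul_of_nonneg_left (hB z (by simpa)) (norm_nonneg (coeff k f))
  simp only [tsum_mul_right, havg] at h
  exact (coeff_toeplitz ..).trans h.tsum_eq

theorem continuousOn_tsum_coeff_mul_pow {f : ℂ⟦X⟧} (hf : Summable fun k : ℕ => ‖coeff k f‖) :
    ContinuousOn (fun z => ∑' k : ℕ, coeff k f * z ^ k) (Metric.sphere 0 1) :=
  continuousOn_tsum (fun k => by fun_prop) hf fun k z hz => by
    simp [mem_sphere_zero_iff_norm.1 hz]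

theorem HasCoeffBound.summable_norm_coeff_rescale {f : ℂ⟦X⟧} {a : ℝ} (hf : HasCoeffBound f a)
    {ρ : ℝ} (hρ : ρ ∈ Set.Ioo 0 1) : Summable fun k : ℕ => ‖coeff k (rescale (ρ : ℂ) f)‖ := by
  simp only [coeff_rescale, mul_comm _ (coeff _ f)]
  exact hf.summable_mul_pow (by rw [Complex.norm_of_nonneg hρ.1.le]; exact hρ.2)

theorem tendsto_coeff_toeplitz_rescale {φ : ℂ → ℂ} {f : ℂ⟦X⟧} {a : ℝ} (hf : HasCoeffBound f a)
    (hφ : SmoothOnCircle φ) (n : ℕ) :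
    Tendsto (fun ρ : ℝ => coeff n (toeplitz φ (rescale (ρ : ℂ) f))) (𝓝[<] 1)
      (𝓝 (coeff n (toeplitz φ f))) := by
  simp only [coeff_toeplitz]
  refine tendsto_tsum_of_dominated_convergence (hf.summable_mul_circleCoeff hφ n) (fun k => ?_) ?_
  · have hcont : Continuous fun ρ : ℝ => coeff k (rescale (ρ : ℂ) f) * circleCoeff φ (n - k) := by
      simp only [coeff_rescale]
      fun_prop
    simpa [coeff_rescale] using (hcont.tendsto 1).mono_left nhdsWithin_le_nhds
  · filter_upwards [Ioo_mem_nhdsLT one_pos] with ρ hρ k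
    rw [coeff_rescale, mul_assoc, norm_mul, norm_pow, Complex.norm_of_nonneg hρ.1.le]
    exact mul_le_of_le_one_left (norm_nonneg _) (pow_le_one₀ hρ.1.le hρ.2.le)

/-- A Toeplitz operator sees a power series only through its Abel means on the circle. -/
theorem toeplitz_eq_toeplitz {φ ψ : ℂ → ℂ} {f g : ℂ⟦X⟧} {a b K : ℝ} (hf : HasCoeffBound f a)
    (hg : HasCoeffBound g b) (hφ : SmoothOnCircle φ) (hψ : SmoothOnCircle ψ)
    (h : ∀ᶠ ρ : ℝ in 𝓝[<] 1, ∀ z : ℂ, ‖z‖ = 1 → ‖(∑' k : ℕ, coeff k f * (ρ * z) ^ k) * φ z -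
      (∑' k : ℕ, coeff k g * (ρ * z) ^ k) * ψ z‖ ≤ K * (1 - ρ)) :
    toeplitz φ f = toeplitz ψ g := by
  ext n
  have hlim := (tendsto_coeff_toeplitz_rescale hf hφ n).sub (tendsto_coeff_toeplitz_rescale hg hψ n)
  have hK : Tendsto (fun ρ : ℝ => K * (1 - ρ)) (𝓝[<] 1) (𝓝 0) := by
    have hcont : Continuous fun ρ : ℝ => K * (1 - ρ) := by fun_prop
    simpa using (hcont.tendsto 1).mono_left nhdsWithin_le_nhds
  refine sub_eq_zero.1 (tendsto_nhds_unique hlim (squeeze_zero_norm' ?_ hK))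
  filter_upwards [h, Ioo_mem_nhdsLT one_pos] with ρ hρ hρ01
  have hfρ := hf.summable_norm_coeff_rescale hρ01
  have hgρ := hg.summable_norm_coeff_rescale hρ01
  have hintf := circleIntegrable_mul_zpow
    ((continuousOn_tsum_coeff_mul_pow hfρ).fun_mul hφ.continuousOn) (-n)
  have hintg := circleIntegrable_mul_zpow
    ((continuousOn_tsum_coeff_mul_pow hgρ).fun_mul hψ.continuousOn) (-n)
  simp only [coeff_toeplitz_eq_circleAverage hφ.continuousOn hfρ,
    coeff_toeplitz_eq_circleAverage hψ.continuousOn hgρ, ← mul_assoc]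
  rw [← Real.circleAverage_fun_sub hintf hintg]
  refine norm_circleAverage_le fun z hz => ?_
  rw [← sub_mul, norm_mul, norm_zpow, hz, one_zpow, mul_one]
  simpa only [coeff_rescale, mul_pow, mul_left_comm, mul_assoc] using hρ z hz

theorem norm_cpow_le_of_norm_le_two {w s : ℂ} (hs : 0 ≤ s.re) (hw : ‖w‖ ≤ 2) :
    ‖w ^ s‖ ≤ 2 ^ s.re * Real.exp (Real.pi * |s.im|) := by
  have harg : -(Real.pi * |s.im|) ≤ w.arg * s.im := by
    refine (neg_le_neg ?_).trans (neg_abs_le _)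
    rw [abs_mul]
    gcongr
    exact Complex.abs_arg_le_pi w
  calc ‖w ^ s‖ ≤ ‖w‖ ^ s.re / Real.exp (w.arg * s.im) := Complex.norm_cpow_le w s
    _ ≤ 2 ^ s.re / Real.exp (-(Real.pi * |s.im|)) := by gcongr
    _ = _ := by rw [Real.exp_neg, div_inv_eq_mul]

/-- Near `1`, `f` sums to `F` in the unit disc. -/
def HasSumNearOne (f : ℂ⟦X⟧) (F : ℂ → ℂ) : Prop :=
  ∀ᶠ ζ in 𝓝 1, ‖ζ‖ < 1 → HasSum (fun n : ℕ => coeff n f * ζ ^ n) (F ζ)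

section Localisation

variable {f : ℂ⟦X⟧} {a b : ℝ} {s : ℂ} {r : ℂ → ℂ}

theorem exists_norm_tsum_sub_tsum_mul_le (hs : 0 ≤ s.re) (hr : AnalyticAt ℂ r 1)
    (hfr : HasSumNearOne f fun ζ => (1 - ζ) ^ s * r ζ) :
    ∃ K : ℝ, 0 ≤ K ∧ ∃ δ > (0 : ℝ), ∀ ρ ∈ Set.Ioo (1 - δ) 1, 0 < ρ →
      ∀ z : ℂ, ‖z‖ = 1 → dist z 1 < δ →
      ‖∑' k : ℕ, coeff k f * (ρ * z) ^ k -
        (∑' k : ℕ, coeff k (oneSubCPow (-s)) * (ρ * z) ^ k) * r z‖ ≤ K * (1 - ρ) := by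
  obtain ⟨L, t, ht, hL⟩ := (hr.contDiffAt (n := 1)).exists_lipschitzOnWith
  obtain ⟨ε, hε, hball⟩ := Metric.eventually_nhds_iff_ball.1 (hfr.and ht)
  refine ⟨2 ^ s.re * Real.exp (Real.pi * |s.im|) * L, by positivity, ε / 2,
    half_pos hε, fun ρ hρ hρ0 z hz hzε => ?_⟩
  have hρz : dist (ρ * z) z = 1 - ρ := by
    rw [dist_eq_norm, ← sub_one_mul, norm_mul, hz, mul_one, ← Complex.ofReal_one,
      ← Complex.ofReal_sub, Complex.norm_real, Real.norm_of_nonpos (by linarith [hρ.2]), neg_sub]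
  have hρz1 : ‖ρ * z‖ < 1 := by
    rw [norm_mul, hz, mul_one, Complex.norm_of_nonneg hρ0.le]
    exact hρ.2
  have hzball : z ∈ Metric.ball 1 ε := Metric.mem_ball.2 (by linarith)
  have hρzball : ρ * z ∈ Metric.ball 1 ε :=
    Metric.mem_ball.2 (by linarith [dist_triangle (ρ * z) z 1, hρ.1])
  have hlip : ‖r (ρ * z) - r z‖ ≤ L * (1 - ρ) := by
    rw [← dist_eq_norm, ← hρz]
    exact hL.dist_le_mul _ (hball _ hρzball).2 _ (hball _ hzball).2
  have hpow : ‖(1 - ρ * z) ^ s‖ ≤ 2 ^ s.re * Real.exp (Real.pi * |s.im|) :=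
    norm_cpow_le_of_norm_le_two hs ((norm_sub_le _ _).trans (by rw [norm_one]; linarith))
  rw [((hball _ hρzball).1 hρz1).tsum_eq, (hasSum_oneSubCPow (-s) hρz1).tsum_eq, neg_neg,
    ← mul_sub, norm_mul, mul_assoc]
  exact mul_le_mul hpow hlip (norm_nonneg _) (by positivity)

theorem SmoothOnCircle.analytic_mul_of_eq_zero {ψ : ℂ → ℂ} {ε δ : ℝ} (hψ : SmoothOnCircle ψ)
    (hδε : δ < ε) (hr : ∀ z ∈ Metric.ball 1 ε, AnalyticAt ℂ r z)
    (hψ0 : ∀ z, δ ≤ dist z 1 → ψ z = 0) : SmoothOnCircle fun z => r z * ψ z := fun z hz => by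
  rcases lt_or_ge (dist z 1) ε with hzε | hzε
  · exact ((hr z hzε).contDiffAt.restrict_scalars ℝ).mul (hψ z hz)
  · have hfar : ∀ᶠ w in 𝓝 z, δ < dist w 1 :=
      (continuous_id.dist continuous_const).continuousAt.eventually_const_lt (hδε.trans_le hzε)
    exact (contDiffAt_const (c := (0 : ℂ))).congr_of_eventuallyEq
      (hfar.mono fun w hw => by simp [hψ0 w hw.le])

theorem exists_hasCoeffBound_toeplitz_of_near_one (hf : HasCoeffBound f b) (hs : 0 ≤ s.re)
    (hr : AnalyticAt ℂ r 1)
    (hfr : HasSumNearOne f fun ζ => (1 - ζ) ^ s * r ζ) :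
    ∃ δ > 0, ∀ ψ : ℂ → ℂ, SmoothOnCircle ψ → (∀ z, δ ≤ dist z 1 → ψ z = 0) →
      HasCoeffBound (toeplitz ψ f) (-s.re - 1) := by
  obtain ⟨K, hK0, δ, hδ, hK⟩ := exists_norm_tsum_sub_tsum_mul_le hs hr hfr
  obtain ⟨ε, hε, hrε⟩ := Metric.eventually_nhds_iff_ball.1 hr.eventually_analyticAt
  refine ⟨min δ (ε / 2), lt_min hδ (half_pos hε), fun ψ hψ hψ0 => ?_⟩
  obtain ⟨B, hB⟩ := (isCompact_sphere (0 : ℂ) 1).exists_bound_of_continuousOn hψ.continuousOn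
  have hrψ : SmoothOnCircle fun z => r z * ψ z := hψ.analytic_mul_of_eq_zero
    ((min_le_right _ _).trans_lt (half_lt_self hε)) hrε hψ0
  have hone := hasCoeffBound_oneSubCPow (-s)
  rw [toeplitz_eq_toeplitz (K := K * B) hf hone hψ hrψ]
  · exact (hasCoeffBound_toeplitz hone hrψ).mono (by simp)
  filter_upwards [Ioo_mem_nhdsLT one_pos, Ioo_mem_nhdsLT (sub_lt_self 1 hδ)] with ρ hρ hρδ z hz
  rw [← mul_assoc, ← sub_mul, norm_mul, mul_right_comm]
  have hBz : ‖ψ z‖ ≤ B := hB z (by simpa)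
  have hKρ : 0 ≤ K * (1 - ρ) := mul_nonneg hK0 (by linarith [hρ.2])
  rcases lt_or_ge (dist z 1) (min δ (ε / 2)) with hzδ | hzδ
  · exact mul_le_mul (hK ρ hρδ hρ.1 z hz (hzδ.trans_le (min_le_left _ _))) hBz (norm_nonneg _) hKρ
  · rw [hψ0 z hzδ, norm_zero, mul_zero]
    exact mul_nonneg hKρ ((norm_nonneg _).trans hBz)

open scoped ContDiff in
theorem hasCoeffBound_of_one_sub_X_pow_mul {M : ℕ} (hf : HasCoeffBound f b)
    (hM : HasCoeffBound ((1 - X) ^ M * f) a) (hs : 0 ≤ s.re) (hsa : -s.re - 1 ≤ a)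
    (hr : AnalyticAt ℂ r 1)
    (hfr : HasSumNearOne f fun ζ => (1 - ζ) ^ s * r ζ) : HasCoeffBound f a := by
  obtain ⟨δ, hδ, hnear⟩ := exists_hasCoeffBound_toeplitz_of_near_one hf hs hr hfr
  let ψ : ContDiffBump (1 : ℂ) := ⟨δ / 2, δ, half_pos hδ, half_lt_self hδ⟩
  have hψ (z : ℂ) : ContDiffAt ℝ ∞ (fun z => (ψ z : ℂ)) z :=
    Complex.ofRealCLM.contDiff.contDiffAt.comp z ψ.contDiffAt
  have hη : SmoothOnCircle fun z => (1 - ψ z) * ((1 - z) ^ M)⁻¹ := fun z _ => by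
    rcases eq_or_ne z 1 with rfl | hz
    · exact (contDiffAt_const (c := (0 : ℂ))).congr_of_eventuallyEq
        (ψ.eventuallyEq_one.mono fun z hz => by simp [hz])
    · exact (contDiffAt_const.sub (hψ z)).mul
        (.inv (by fun_prop) (pow_ne_zero _ (sub_ne_zero.2 hz.symm)))
  have away : HasCoeffBound (toeplitz (fun z => 1 - ψ z) f) a := by
    rw [toeplitz_congr (ψ := fun z => (1 - z) ^ M * ((1 - ψ z) * ((1 - z) ^ M)⁻¹)) fun z _ => ?_,
      ← toeplitz_one_sub_X_pow_mul hf hη]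
    · exact hasCoeffBound_toeplitz hM hη
    · rcases eq_or_ne z 1 with rfl | hz
      · simp [ψ.eventuallyEq_one.eq_of_nhds]
      · rw [mul_left_comm, mul_inv_cancel₀ (pow_ne_zero _ (sub_ne_zero.2 hz.symm)), mul_one]
  have split : toeplitz (fun z => 1 - ψ z) f = f - toeplitz (fun z => (ψ z : ℂ)) f := by
    rw [toeplitz_sub_left hf (fun z _ => contDiffAt_const) fun z _ => hψ z]
    exact congrArg (· - _) (toeplitz_one f)
  have near := (hnear (fun z => ψ z) (fun z _ => hψ z) fun z hz => by
    simpa using ψ.zero_of_le_dist hz).mono hsa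
  simpa [split] using away.add near

end Localisation

/-! ### Expansion of a product -/

theorem expandAtOne_sub_natCast (γ : ℂ) (S : ℂ⟦X⟧) (N m : ℕ) :
    expandAtOne (γ - m) S N = (1 - X) ^ m * expandAtOne γ S N := by
  rw [expandAtOne_eq_mul_aeval, expandAtOne_eq_mul_aeval, oneSubCPow_sub_natCast]
  ring

theorem HasSumNearOne.sub_expandAtOne {f : ℂ⟦X⟧} {γ : ℂ} {g : ℂ → ℂ}
    (hf : HasSumNearOne f fun ζ => (1 - ζ) ^ (-γ) * g ζ) (hg : AnalyticAt ℂ g 1) (N : ℕ) :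
    ∃ r : ℂ → ℂ, AnalyticAt ℂ r 1 ∧
      HasSumNearOne (f - expandAtOne γ (taylorSeries fun x => g (1 - x)) N)
        fun ζ => (1 - ζ) ^ (N - γ) * r ζ := by
  have hga : AnalyticAt ℂ (fun x => g (1 - x)) 0 :=
    AnalyticAt.fun_comp (by simpa using hg) (by fun_prop)
  obtain ⟨r, hr, hgr⟩ := exists_eventuallyEq_taylorSeries_add hga N
  have hsub : Tendsto (fun ζ : ℂ => 1 - ζ) (𝓝 1) (𝓝 0) :=
    (continuous_const.sub continuous_id).tendsto' _ _ (by simp)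
  refine ⟨fun ζ => r (1 - ζ), AnalyticAt.fun_comp (by simpa using hr) (by fun_prop), ?_⟩
  filter_upwards [hf, hsub.eventually hgr] with ζ hfζ hgζ hζ
  have hζ1 : 1 - ζ ≠ 0 := sub_ne_zero.2 fun h => by simp [← h] at hζ
  have value : (1 - ζ) ^ (-γ) * g ζ - (1 - ζ) ^ (-γ) * ∑ k ∈ Finset.range N,
      coeff k (taylorSeries fun x => g (1 - x)) * (1 - ζ) ^ k =
        (1 - ζ) ^ (N - γ) * r (1 - ζ) := by
    rw [sub_sub_cancel] at hgζ
    rw [hgζ, sub_eq_add_neg (N : ℂ), Complex.cpow_add _ _ hζ1, Complex.cpow_natCast]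
    ring
  have h := (hfζ hζ).sub (hasSum_expandAtOne γ (taylorSeries fun x => g (1 - x)) N hζ)
  simpa only [value, ← sub_mul, ← map_sub] using h

theorem HasCoeffBound.exists_mul {f g : ℂ⟦X⟧} {c d : ℝ} (hf : HasCoeffBound f c)
    (hg : HasCoeffBound g d) : ∃ b, HasCoeffBound (f * g) b := by
  obtain ⟨C, hC0, hC⟩ := (hf.mono (le_abs_self c)).exists_nonneg
  obtain ⟨D, hD0, hD⟩ := (hg.mono (le_abs_self d)).exists_nonneg
  refine ⟨1 + (|c| + |d|), iff_exists.2 ⟨C * D, fun n => ?_⟩⟩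
  have term_le {i j : ℕ} (hij : i + j = n) : ‖coeff i f * coeff j g‖ ≤
      C * D * ((n : ℝ) + 1) ^ (|c| + |d|) := by
    have hi : (i : ℝ) ≤ n := by exact_mod_cast hij ▸ Nat.le_add_right i j
    have hj : (j : ℝ) ≤ n := by exact_mod_cast hij ▸ Nat.le_add_left j i
    calc ‖coeff i f * coeff j g‖ = ‖coeff i f‖ * ‖coeff j g‖ := norm_mul _ _
      _ ≤ (C * ((n : ℝ) + 1) ^ |c|) * (D * ((n : ℝ) + 1) ^ |d|) := by
          gcongr
          exacts [(hC _).trans (by gcongr), (hD _).trans (by gcongr)]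
      _ = _ := by rw [Real.rpow_add (by positivity)]; ring
  calc ‖coeff n (f * g)‖
      ≤ ∑ q ∈ antidiagonal n, C * D * ((n : ℝ) + 1) ^ (|c| + |d|) := by
        rw [coeff_mul]
        exact norm_sum_le_of_le _ fun q hq => term_le (mem_antidiagonal.1 hq)
    _ = C * D * ((n : ℝ) + 1) ^ (1 + (|c| + |d|)) := by
        rw [Finset.sum_const, Finset.Nat.card_antidiagonal, nsmul_eq_mul,
          Real.rpow_add (by positivity) 1, Real.rpow_one]
        push_cast
        ring

theorem HasCoeffBound.mul_aeval_one_sub_X {f : ℂ⟦X⟧} {c : ℝ} (hf : HasCoeffBound f c)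
    (q : Polynomial ℂ) : HasCoeffBound (f * Polynomial.aeval (1 - X : ℂ⟦X⟧) q) c := by
  rw [Polynomial.aeval_eq_sum_range, Finset.mul_sum]
  refine .sum fun k _ => ?_
  rw [smul_eq_C_mul, mul_left_comm]
  exact (hf.mul_one_sub_X_pow k).const_mul _

theorem eventually_hasCoeffBound_sub_expandAtOne {f : ℂ⟦X⟧} {a b : ℝ} {γ : ℂ} {g : ℂ → ℂ} {m : ℕ}
    (hf : HasCoeffBound f b) (hm : HasCoeffBound ((1 - X) ^ m * f) a) (hg : AnalyticAt ℂ g 1)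
    (hfg : HasSumNearOne f fun ζ => (1 - ζ) ^ (-γ) * g ζ) :
    ∀ᶠ N : ℕ in atTop,
      HasCoeffBound (f - expandAtOne γ (taylorSeries fun x => g (1 - x)) N) a := by
  obtain ⟨M, hmM, hM⟩ : ∃ M : ℕ, m ≤ M ∧ γ.re - 1 - a ≤ M :=
    ((eventually_ge_atTop m).and (tendsto_natCast_atTop_atTop.eventually_ge_atTop _)).exists
  filter_upwards [tendsto_natCast_atTop_atTop.eventually_ge_atTop γ.re,
    tendsto_natCast_atTop_atTop.eventually_ge_atTop (γ.re - 1 - a)] with N hN hNa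
  obtain ⟨r, hr, hfr⟩ := hfg.sub_expandAtOne hg N
  have hD := (hf.mono (le_max_left b (γ.re - 1))).sub
    ((hasCoeffBound_expandAtOne γ (taylorSeries fun x => g (1 - x)) N).mono (le_max_right b _))
  refine hasCoeffBound_of_one_sub_X_pow_mul (M := M) hD ?_ ?_ ?_ hr hfr
  · rw [mul_sub, ← expandAtOne_sub_natCast, ← Nat.sub_add_cancel hmM, pow_add, mul_assoc, mul_comm,
      Nat.sub_add_cancel hmM]
    refine (hm.mul_one_sub_X_pow _).sub ((hasCoeffBound_expandAtOne _ _ _).mono ?_)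
    simp only [Complex.sub_re, Complex.natCast_re]
    linarith
  · simpa using hN
  · simp only [Complex.sub_re, Complex.natCast_re]
    linarith

theorem hasCoeffBound_mul_powSeries_sub_expandAtOne {α : ℝ} {W : ℂ⟦X⟧} {g : ℂ → ℂ}
    (hW : HasCoeffBound W (α - 1)) (hg : AnalyticAt ℂ g 1)
    (hWg : HasSumNearOne W fun ζ => (1 - ζ) ^ (-(α : ℂ)) * g ζ) (β : ℂ) (p : ℕ) :
    HasCoeffBound (W * powSeries β -
        expandAtOne (α + β) (taylorSeries (fun x => g (1 - x)) * negLogSeries β) p)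
      (max (α - 1) (α + β.re - 1 - p)) := by
  set c := taylorSeries fun x => g (1 - x)
  obtain ⟨m, hm⟩ := exists_nat_gt (|α - 1| + β.re)
  have hpow : HasCoeffBound ((1 - X) ^ m * (W * oneSubCPow β)) (α - 1) := by
    rw [mul_comm, mul_assoc, ← oneSubCPow_sub_natCast]
    refine hW.mul (hasCoeffBound_oneSubCPow _) ?_
    simp only [Complex.sub_re, Complex.natCast_re]
    linarith
  have hsum : HasSumNearOne (W * oneSubCPow β) fun ζ => (1 - ζ) ^ (-(α + β : ℂ)) * g ζ := by
    filter_upwards [hWg] with ζ hWζ hζ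
    have hζ1 : 1 - ζ ≠ 0 := sub_ne_zero.2 fun h => by simp [← h] at hζ
    convert hW.hasSum_mul (hasCoeffBound_oneSubCPow β) hζ (hWζ hζ) (hasSum_oneSubCPow β hζ) using 1
    rw [neg_add, Complex.cpow_add _ _ hζ1]
    ring
  obtain ⟨b, hb⟩ := hW.exists_mul (hasCoeffBound_oneSubCPow β)
  obtain ⟨N, hpN, hNβ, hN⟩ := ((eventually_ge_atTop p).and
    ((tendsto_natCast_atTop_atTop.eventually_gt_atTop (|α - 1| + β.re)).and
    (eventually_hasCoeffBound_sub_expandAtOne hb hpow hg hsum))).exists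
  have tail : HasCoeffBound (W * (powSeries β - expandAtOne β (negLogSeries β) N)) (α - 1) :=
    hW.mul (hasCoeffBound_powSeries_sub_expandAtOne β N) (by linarith)
  have remainder := hN.mul_aeval_one_sub_X (trunc N (negLogSeries β))
  have product := hasCoeffBound_expandAtOne_mul_sub α β c (negLogSeries β) hpN
  rw [Complex.ofReal_re] at product
  convert ((tail.add remainder).mono (le_max_left _ _)).add
    (product.mono (le_max_right _ _)) using 1
  rw [expandAtOne_eq_mul_aeval β, expandAtOne_eq_mul_aeval α,
    expandAtOne_eq_mul_aeval (α + β) c N, oneSubCPow_add]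
  ring

theorem eq_zero_of_hasCoeffBound_C_mul_oneSubCPow {a γ : ℂ} {c : ℝ} (hγ : 0 < γ.re)
    (hc : c < γ.re - 1) (h : HasCoeffBound (C a * oneSubCPow γ) c) : a = 0 := by
  have hlim := (tendsto_coeff_oneSubCPow γ).const_mul a
  have hsmall : (fun n : ℕ => a * (coeff n (oneSubCPow γ) * (n : ℂ) ^ (1 - γ))) =O[atTop]
      fun n : ℕ => (n : ℝ) ^ (-(γ.re - 1 - c)) := by
    refine (IsBigO.mul h (isTheta_natCast_cpow (1 - γ)).isBigO).congr' ?_ ?_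
    · simp only [coeff_C_mul, mul_assoc, EventuallyEq.rfl]
    · filter_upwards [eventually_gt_atTop 0] with n hn
      rw [← Real.rpow_add (by exact_mod_cast hn), Complex.sub_re, Complex.one_re]
      ring_nf
  have hzero := hsmall.trans_tendsto
    ((tendsto_rpow_neg_atTop (by linarith)).comp tendsto_natCast_atTop_atTop)
  exact (mul_eq_zero.1 (tendsto_nhds_unique hlim hzero)).resolve_right
    (inv_ne_zero (Complex.Gamma_ne_zero_of_re_pos hγ))

theorem X_pow_dvd_of_hasCoeffBound_expandAtOne {γ : ℂ} {S : ℂ⟦X⟧} {p : ℕ} (hγ : p < γ.re)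
    (h : HasCoeffBound (expandAtOne γ S p) (γ.re - 1 - p)) : X ^ p ∣ S := by
  induction p with
  | zero => simp
  | succ p ih =>
    push_cast at hγ h
    have hdvd : X ^ p ∣ S := by
      refine ih (by linarith) ?_
      simpa using (h.mono (by linarith)).sub
        (hasCoeffBound_expandAtOne_sub_expandAtOne γ S p.le_succ)
    have hlead : expandAtOne γ S (p + 1) = C (coeff p S) * oneSubCPow (γ - p) := by
      rw [expandAtOne, Finset.sum_range_succ, add_eq_right]
      exact Finset.sum_eq_zero fun k hk => by
        rw [X_pow_dvd_iff.1 hdvd k (Finset.mem_range.1 hk), map_zero, zero_mul]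
    rw [hlead] at h
    have hp : coeff p S = 0 := eq_zero_of_hasCoeffBound_C_mul_oneSubCPow
      (by simp; linarith) (by simp; linarith) h
    exact X_pow_dvd_iff.2 fun k hk =>
      (Nat.lt_succ_iff_lt_or_eq.1 hk).elim (X_pow_dvd_iff.1 hdvd k) fun hkp => hkp ▸ hp

/-! ### Stability and consistency -/

theorem norm_exp_neg_natCast_mul (σ : ℂ) (n : ℕ) (h : ℝ) :
    ‖Complex.exp (-(n : ℂ) * σ * (h : ℂ))‖ = Real.exp (-(n * h * σ.re)) := by
  rw [Complex.norm_exp, Complex.re_mul_ofReal, neg_mul, Complex.neg_re, ← Complex.ofReal_natCast,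
    Complex.re_ofReal_mul]
  ring_nf

theorem cqStable_iff {σ : ℂ} {α : ℝ} {ω : ℕ → ℂ} :
    CQStable α (weightedCQ σ ω) ↔ HasCoeffBound (.mk ω) (α - 1) := by
  simp only [CQStable, HasCoeffBound.iff_exists_one_le, coeff_mk, weightedCQ, norm_mul,
    norm_exp_neg_natCast_mul]
  constructor
  · intro h
    obtain ⟨C, hC⟩ := h 1 one_pos
    refine ⟨Real.exp σ.re * C, fun n hn => ?_⟩
    have hn0 : (0 : ℝ) < n := by exact_mod_cast hn
    have hnh : (n : ℝ) * (n : ℝ)⁻¹ = 1 := mul_inv_cancel₀ hn0.ne'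
    have hCn := hC (n : ℝ)⁻¹ n (inv_pos.2 hn0) hn hnh.le
    rwa [hnh, one_mul, Real.exp_neg, inv_mul_le_iff₀ (Real.exp_pos _), ← mul_assoc] at hCn
  · rintro ⟨C, hC⟩ B -
    refine ⟨Real.exp (B * |σ.re|) * C, fun h n hh hn hnh => ?_⟩
    have hexponent : -(n * h * σ.re) ≤ B * |σ.re| := calc
      -(n * h * σ.re) = n * h * -σ.re := by ring
      _ ≤ n * h * |σ.re| := by gcongr; exact neg_le_abs _
      _ ≤ B * |σ.re| := by gcongr
    rw [mul_assoc (Real.exp _)]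
    exact mul_le_mul (Real.exp_le_exp.2 hexponent) (hC n hn) (norm_nonneg _) (Real.exp_pos _).le

theorem weightedCQ_mul_pow (σ : ℂ) (ω : ℕ → ℂ) (h : ℝ) (n : ℕ) :
    weightedCQ σ ω h n * (Complex.exp (σ * h) * Complex.exp (-(h : ℂ))) ^ n =
      ω n * Complex.exp (-(h : ℂ)) ^ n := by
  have hcancel : Complex.exp (-(n : ℂ) * σ * h) * Complex.exp (σ * h) ^ n = 1 := by
    rw [← Complex.exp_nat_mul, ← Complex.exp_add, mul_assoc, neg_mul, neg_add_cancel,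
      Complex.exp_zero]
  rw [weightedCQ, mul_pow]
  linear_combination (ω n * Complex.exp (-(h : ℂ)) ^ n) * hcancel

theorem one_sub_exp_neg_pos {h : ℝ} (hh : 0 < h) : 0 < 1 - Real.exp (-h) := by
  simpa using hh

theorem ofReal_one_sub_exp_neg (h : ℝ) :
    ((1 - Real.exp (-h) : ℝ) : ℂ) = 1 - Complex.exp (-(h : ℂ)) := by
  push_cast
  rfl

theorem one_sub_exp_neg_ne_zero {h : ℝ} (hh : 0 < h) : 1 - Complex.exp (-(h : ℂ)) ≠ 0 := by
  rw [← ofReal_one_sub_exp_neg]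
  exact_mod_cast (one_sub_exp_neg_pos hh).ne'

theorem negLogDiv_one_sub_exp_neg {h : ℝ} (hh : 0 < h) :
    negLogDiv (1 - Complex.exp (-(h : ℂ))) = ((h / (1 - Real.exp (-h)) : ℝ) : ℂ) := by
  have hlog : Complex.log (Complex.exp (-(h : ℂ))) = -(h : ℂ) := by
    rw [← Complex.ofReal_neg, ← Complex.ofReal_exp, ← Complex.ofReal_log (Real.exp_pos _).le,
      Real.log_exp]
  rw [Complex.ofReal_div, ofReal_one_sub_exp_neg, eq_div_iff (one_sub_exp_neg_ne_zero hh),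
    mul_comm, mul_negLogDiv, sub_sub_cancel, hlog, neg_neg]

theorem negLogDiv_one_sub_exp_neg_ne_zero {h : ℝ} (hh : 0 < h) :
    negLogDiv (1 - Complex.exp (-(h : ℂ))) ≠ 0 := by
  rw [negLogDiv_one_sub_exp_neg hh]
  exact_mod_cast (div_pos hh (one_sub_exp_neg_pos hh)).ne'

theorem rpow_mul_one_sub_exp_neg_cpow {h : ℝ} (hh : 0 < h) (α : ℝ) :
    ((h ^ α : ℝ) : ℂ) * (1 - Complex.exp (-(h : ℂ))) ^ (-(α : ℂ)) =
      negLogDiv (1 - Complex.exp (-(h : ℂ))) ^ (α : ℂ) := by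
  have hpos := one_sub_exp_neg_pos hh
  rw [negLogDiv_one_sub_exp_neg hh, ← ofReal_one_sub_exp_neg, ← Complex.ofReal_neg,
    ← Complex.ofReal_cpow hpos.le, ← Complex.ofReal_cpow (div_pos hh hpos).le,
    ← Complex.ofReal_mul, Real.div_rpow hh.le hpos.le, Real.rpow_neg hpos.le, div_eq_mul_inv]

theorem isTheta_one_sub_exp_neg :
    (fun h : ℝ => 1 - Complex.exp (-(h : ℂ))) =Θ[𝓝 0] fun h : ℝ => h := by
  have h : HasDerivAt (fun h : ℝ => 1 - Complex.exp (-(h : ℂ))) 1 0 := by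
    simpa using ((hasDerivAt_id (0 : ℂ)).neg.cexp.const_sub 1).comp_ofReal
  have h_pair : Tendsto (fun h : ℝ => (h, (0 : ℝ))) (𝓝 0) (𝓝 0 ×ˢ pure 0) :=
    tendsto_id.prodMk tendsto_const_pure
  have h_sub := h.isTheta_sub one_ne_zero
  simpa [Function.comp_def, IsTheta] using And.intro (h_sub.1.comp_tendsto h_pair)
    (h_sub.2.comp_tendsto h_pair)

theorem tendsto_one_sub_exp_neg :
    Tendsto (fun h : ℝ => 1 - Complex.exp (-(h : ℂ))) (𝓝[>] 0) (𝓝[≠] 0) := by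
  refine tendsto_nhdsWithin_iff.2 ⟨?_, ?_⟩
  · have h : Continuous fun h : ℝ => 1 - Complex.exp (-(h : ℂ)) := by fun_prop
    simpa using (h.tendsto 0).mono_left nhdsWithin_le_nhds
  · filter_upwards [self_mem_nhdsWithin] with h hh using one_sub_exp_neg_ne_zero hh

theorem isTheta_negLogDiv_one_sub_exp_neg_cpow (γ : ℂ) :
    (fun h : ℝ => negLogDiv (1 - Complex.exp (-(h : ℂ))) ^ γ) =Θ[𝓝[>] 0]
      fun _ : ℝ => (1 : ℂ) := by
  have h := (analyticAt_negLogDiv_cpow (-γ)).continuousAt.tendsto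
  rw [neg_neg, negLogDiv_zero, Complex.one_cpow] at h
  exact ((isEquivalent_const_iff_tendsto one_ne_zero).2
    (h.comp (tendsto_one_sub_exp_neg.mono_right nhdsWithin_le_nhds))).isTheta

section Consistency

variable {α : ℝ} {ω : ℕ → ℂ} {g : ℂ → ℂ}

theorem eventually_hasSum_weightedCQ (σ : ℂ)
    (hω : HasSumNearOne (.mk ω) fun ζ => (1 - ζ) ^ (-(α : ℂ)) * g ζ) :
    ∀ᶠ h : ℝ in 𝓝[>] 0, HasSum (fun n : ℕ => weightedCQ σ ω h n *
      (Complex.exp (σ * h) * Complex.exp (-(h : ℂ))) ^ n)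
        ((1 - Complex.exp (-(h : ℂ))) ^ (-(α : ℂ)) * g (Complex.exp (-(h : ℂ)))) := by
  have htendsto : Tendsto (fun h : ℝ => Complex.exp (-(h : ℂ))) (𝓝[>] 0) (𝓝 1) := by
    have h : Continuous fun h : ℝ => Complex.exp (-(h : ℂ)) := by fun_prop
    simpa using (h.tendsto 0).mono_left nhdsWithin_le_nhds
  filter_upwards [htendsto.eventually hω, self_mem_nhdsWithin] with h hsum hh
  simp only [coeff_mk] at hsum
  simp only [weightedCQ_mul_pow]
  refine hsum ?_
  rw [← Complex.ofReal_neg, Complex.norm_exp_ofReal]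
  simpa using hh

theorem rpow_mul_tsum_weightedCQ_sub_one_eventuallyEq (σ : ℂ)
    (hω : HasSumNearOne (.mk ω) fun ζ => (1 - ζ) ^ (-(α : ℂ)) * g ζ) :
    (fun h : ℝ => ((h ^ α : ℝ) : ℂ) * (∑' n : ℕ, weightedCQ σ ω h n *
      (Complex.exp (σ * h) * Complex.exp (-(h : ℂ))) ^ n) - 1) =ᶠ[𝓝[>] 0]
      fun h : ℝ => negLogDiv (1 - Complex.exp (-(h : ℂ))) ^ (α : ℂ) *
        (g (Complex.exp (-(h : ℂ))) - negLogDiv (1 - Complex.exp (-(h : ℂ))) ^ (-(α : ℂ))) := by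
  filter_upwards [eventually_hasSum_weightedCQ σ hω, self_mem_nhdsWithin] with h hsum hh
  rw [hsum.tsum_eq, ← mul_assoc, rpow_mul_one_sub_exp_neg_cpow hh, mul_sub,
    ← Complex.cpow_add _ _ (negLogDiv_one_sub_exp_neg_ne_zero hh), add_neg_cancel,
    Complex.cpow_zero]

theorem cqConsistent_iff {σ : ℂ} {p : ℕ} (hg : AnalyticAt ℂ g 1)
    (hω : HasSumNearOne (.mk ω) fun ζ => (1 - ζ) ^ (-(α : ℂ)) * g ζ) :
    CQConsistent σ α p (weightedCQ σ ω) ↔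
      X ^ p ∣ taylorSeries (fun x => g (1 - x)) - negLogSeries α := by
  have hg0 : AnalyticAt ℂ (fun x => g (1 - x)) 0 :=
    AnalyticAt.fun_comp_of_eq hg (by fun_prop) (sub_zero 1)
  have hneg := analyticAt_negLogDiv_cpow α
  have hsummable := (eventually_hasSum_weightedCQ σ hω).mono fun _ h => h.summable
  have hl : map (fun h : ℝ => 1 - Complex.exp (-(h : ℂ))) (𝓝[>] 0) ≤ 𝓝[≠] 0 :=
    tendsto_one_sub_exp_neg
  rw [CQConsistent, and_iff_right hsummable,
    isBigO_congr (rpow_mul_tsum_weightedCQ_sub_one_eventuallyEq σ hω) .rfl,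
    ((isTheta_negLogDiv_one_sub_exp_neg_cpow α).mul (isTheta_refl _ _)).isBigO_congr_left,
    ← ((isTheta_one_sub_exp_neg.mono nhdsWithin_le_nhds).pow p).isBigO_congr_right,
    negLogSeries, ← taylorSeries_sub hg0 hneg,
    X_pow_dvd_taylorSeries_iff_isBigO (hg0.fun_sub hneg) hl, isBigO_map]
  simp [Function.comp_def]

end Consistency

/-! ### Fractional substantial integrals of powers -/

namespace HasFinitePart

variable {F G : ℝ → ℂ} {c d : ℂ}

theorem congr (h : HasFinitePart F c) (hFG : F =ᶠ[𝓝[>] 0] G) : HasFinitePart G c := by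
  obtain ⟨k, a, l, hl, ht⟩ := h
  exact ⟨k, a, l, hl, ht.congr' (hFG.mono fun ε hε => by rw [hε])⟩

theorem const_mul (h : HasFinitePart F c) (b : ℂ) : HasFinitePart (fun ε => b * F ε) (b * c) := by
  obtain ⟨k, a, l, hl, ht⟩ := h
  refine ⟨k, fun i => b * a i, l, hl, (ht.const_mul b).congr fun ε => ?_⟩
  simp only [mul_sub, Finset.mul_sum, mul_assoc]

theorem add (hF : HasFinitePart F c) (hG : HasFinitePart G d) :
    HasFinitePart (fun ε => F ε + G ε) (c + d) := by
  obtain ⟨k, a, l, hl, h⟩ := hF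
  obtain ⟨k', a', l', hl', h'⟩ := hG
  refine ⟨k + k', Fin.append a a', Fin.append l l', fun i => ?_, (h.add h').congr fun ε => ?_⟩
  · refine Fin.addCases (fun j => ?_) (fun j => ?_) i
    · simpa only [Fin.append_left] using hl j
    · simpa only [Fin.append_right] using hl' j
  · simp only [Fin.sum_univ_add, Fin.append_left, Fin.append_right]
    ring

theorem of_tendsto (h : Tendsto F (𝓝[>] 0) (𝓝 c)) : HasFinitePart F c :=
  ⟨0, Fin.elim0, Fin.elim0, fun i => i.elim0, by simpa using h⟩

end HasFinitePart

theorem cpow_add_one {z : ℂ} (hz : z ≠ 0) (b : ℂ) : z ^ (b + 1) = z ^ b * z := by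
  rw [Complex.cpow_add _ _ hz, Complex.cpow_one]

theorem tendsto_ofReal_cpow_zero {b : ℂ} (hb : 0 < b.re) :
    Tendsto (fun ε : ℝ => (ε : ℂ) ^ b) (𝓝[>] 0) (𝓝 0) := by
  have hb0 : b ≠ 0 := by rintro rfl; exact lt_irrefl _ hb
  simpa [hb0] using
    ((Complex.continuous_ofReal_cpow_const hb).tendsto 0).mono_left nhdsWithin_le_nhds

theorem hasFinitePart_cpow_mul {b : ℂ} (hb : ∀ k : ℕ, b ≠ -k) {f : ℂ → ℂ}
    (hf : AnalyticAt ℂ f 0) : HasFinitePart (fun ε : ℝ => (ε : ℂ) ^ b * f ε) 0 := by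
  obtain ⟨N, hN⟩ := exists_nat_gt (-b.re)
  obtain ⟨r, hr, hfr⟩ := exists_eventuallyEq_taylorSeries_add hf N
  have hcoe : Tendsto (fun ε : ℝ => (ε : ℂ)) (𝓝[>] 0) (𝓝 0) :=
    (Complex.continuous_ofReal.tendsto 0).mono_left nhdsWithin_le_nhds
  have hremainder : Tendsto (fun ε : ℝ => (ε : ℂ) ^ (b + N) * r ε) (𝓝[>] 0) (𝓝 0) := by
    have hpow := tendsto_ofReal_cpow_zero (b := b + N) (by simp; linarith)
    simpa using hpow.mul (hr.continuousAt.tendsto.comp hcoe)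
  refine ⟨N, fun i => coeff (i : ℕ) (taylorSeries f), fun i => b + (i : ℕ), fun i hi =>
    hb i (eq_neg_of_add_eq_zero_left hi), hremainder.congr' ?_⟩
  filter_upwards [self_mem_nhdsWithin, hcoe.eventually hfr] with ε hε hfε
  have hε0 : (ε : ℂ) ≠ 0 := by exact_mod_cast (ne_of_gt hε)
  rw [Fin.sum_univ_eq_sum_range fun i => coeff i (taylorSeries f) * (ε : ℂ) ^ (b + (i : ℂ)), hfε]
  simp only [Complex.cpow_add _ _ hε0, Complex.cpow_natCast, mul_add, Finset.mul_sum]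
  rw [mul_assoc, eq_sub_iff_add_eq, add_comm]
  congr! 2
  ring

/-- The Beta integral over `[ε, x]`. -/
noncomputable def cutBeta (x : ℝ) (u v : ℂ) (ε : ℝ) : ℂ :=
  ∫ τ in ε..x, (τ : ℂ) ^ (u - 1) * ((x : ℂ) - τ) ^ (v - 1)

section CutBeta

variable {x ε : ℝ} {u v : ℂ}

theorem continuousAt_ofReal_cpow_of_pos {t : ℝ} (ht : 0 < t) (z : ℂ) :
    ContinuousAt (fun t : ℝ => (t : ℂ) ^ z) t :=
  Complex.continuous_ofReal.continuousAt.cpow continuousAt_const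
    (Complex.ofReal_mem_slitPlane.2 ht)

theorem intervalIntegrable_cutBeta (u : ℂ) (hv : 0 < v.re) (hε : 0 < ε) (hεx : ε ≤ x) :
    IntervalIntegrable (fun τ : ℝ => (τ : ℂ) ^ (u - 1) * ((x : ℂ) - τ) ^ (v - 1)) volume ε x := by
  refine IntervalIntegrable.continuousOn_mul ?_ fun τ hτ => ?_
  · simpa using (intervalIntegral.intervalIntegrable_cpow' (a := x - ε) (b := 0) (r := v - 1)
      (by simpa using hv)).comp_sub_left x
  · rw [Set.uIcc_of_le hεx] at hτ
    exact (continuousAt_ofReal_cpow_of_pos (hε.trans_le hτ.1) _).continuousWithinAt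

theorem intervalIntegrable_cutBeta_zero (hu : 0 < u.re) (hv : 0 < v.re) (hx : 0 < x) :
    IntervalIntegrable (fun τ : ℝ => (τ : ℂ) ^ (u - 1) * ((x : ℂ) - τ) ^ (v - 1)) volume 0 x := by
  have hleft := (intervalIntegrable_cutBeta v hu (half_pos hx) (half_le_self hx.le)).comp_sub_left x
  rw [sub_half, sub_self] at hleft
  refine .trans (hleft.symm.congr fun τ _ => ?_)
    (intervalIntegrable_cutBeta u hv (half_pos hx) (half_le_self hx.le))
  push_cast
  rw [sub_sub_cancel, mul_comm]

theorem cutBeta_zero (hu : 0 < u.re) (hv : 0 < v.re) (hx : 0 < x) : cutBeta x u v 0 =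
    Complex.Gamma u * Complex.Gamma v / Complex.Gamma (u + v) * (x : ℂ) ^ (u + v - 1) := by
  have hΓ : Complex.Gamma (u + v) ≠ 0 := Complex.Gamma_ne_zero_of_re_pos (add_pos hu hv)
  rw [cutBeta, Complex.betaIntegral_scaled u v hx, Complex.Gamma_mul_Gamma_eq_betaIntegral hu hv,
    mul_div_cancel_left₀ _ hΓ, mul_comm]

theorem tendsto_cutBeta_zero (hu : 0 < u.re) (hv : 0 < v.re) (hx : 0 < x) :
    Tendsto (cutBeta x u v) (𝓝[>] 0) (𝓝 (cutBeta x u v 0)) := by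
  have hint := intervalIntegrable_cutBeta_zero hu hv hx
  rw [intervalIntegrable_iff_integrableOn_Icc_of_le hx.le, ← Set.uIcc_of_le hx.le] at hint
  have hcont := (intervalIntegral.continuousOn_primitive_interval_left hint 0 (by simp)).tendsto
  rw [Set.uIcc_of_le hx.le, nhdsWithin_Icc_eq_nhdsGE hx] at hcont
  exact hcont.mono_left (nhdsWithin_mono _ Set.Ioi_subset_Ici_self)

theorem mul_cutBeta (hv : 0 < v.re) (hε : 0 < ε) (hεx : ε ≤ x) :
    x * cutBeta x u v ε = cutBeta x (u + 1) v ε + cutBeta x u (v + 1) ε := by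
  have hv1 : 0 < (v + 1).re := by simp; linarith
  simp only [cutBeta]
  rw [← intervalIntegral.integral_add (intervalIntegrable_cutBeta _ hv hε hεx)
    (intervalIntegrable_cutBeta _ hv1 hε hεx), ← intervalIntegral.integral_const_mul]
  refine intervalIntegral.integral_congr_Ioo_of_le hεx fun τ hτ => ?_
  have hτ0 : (τ : ℂ) ≠ 0 := by exact_mod_cast (hε.trans hτ.1).ne'
  have hxτ : (x : ℂ) - τ ≠ 0 := sub_ne_zero.2 (by exact_mod_cast hτ.2.ne')
  simp only [add_sub_cancel_right]
  have hu1 : (τ : ℂ) ^ u = (τ : ℂ) ^ (u - 1) * τ := by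
    rw [← cpow_add_one hτ0, sub_add_cancel]
  have hv1 : ((x : ℂ) - τ) ^ v = ((x : ℂ) - τ) ^ (v - 1) * ((x : ℂ) - τ) := by
    rw [← cpow_add_one hxτ, sub_add_cancel]
  rw [hu1, hv1]
  ring

theorem hasDerivAt_cpow_mul_sub_cpow (u v : ℂ) {τ : ℝ} (hτ : 0 < τ) (hτx : τ < x) :
    HasDerivAt (fun τ : ℝ => (τ : ℂ) ^ u * ((x : ℂ) - τ) ^ v)
      (u * ((τ : ℂ) ^ (u - 1) * ((x : ℂ) - τ) ^ v) -
        v * ((τ : ℂ) ^ u * ((x : ℂ) - τ) ^ (v - 1))) τ := by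
  have hleft : HasDerivAt (fun z : ℂ => z ^ u) (u * (τ : ℂ) ^ (u - 1) * 1) τ :=
    (hasDerivAt_id (τ : ℂ)).cpow_const (Complex.ofReal_mem_slitPlane.2 hτ)
  have hslit : (x : ℂ) - τ ∈ Complex.slitPlane := by
    rw [← Complex.ofReal_sub]
    exact Complex.ofReal_mem_slitPlane.2 (sub_pos.2 hτx)
  have hright : HasDerivAt (fun z : ℂ => ((x : ℂ) - z) ^ v)
      (v * ((x : ℂ) - τ) ^ (v - 1) * -1) τ :=
    ((hasDerivAt_id (τ : ℂ)).const_sub (x : ℂ)).cpow_const hslit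
  exact (hleft.mul hright).comp_ofReal.congr_deriv (by ring)

theorem mul_cutBeta_add_one (hv : 0 < v.re) (hε : 0 < ε) (hεx : ε ≤ x) :
    u * cutBeta x u (v + 1) ε =
      v * cutBeta x (u + 1) v ε - (ε : ℂ) ^ u * ((x : ℂ) - ε) ^ v := by
  have hv0 : v ≠ 0 := by rintro rfl; exact lt_irrefl _ hv
  have hv1 : 0 < (v + 1).re := by simp; linarith
  have hint1 := (intervalIntegrable_cutBeta u hv1 hε hεx).const_mul u
  have hint2 := (intervalIntegrable_cutBeta (u + 1) hv hε hεx).const_mul v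
  rw [add_sub_cancel_right] at hint1 hint2
  have hcont : ContinuousOn (fun τ : ℝ => (τ : ℂ) ^ u * ((x : ℂ) - τ) ^ v) (Set.Icc ε x) := by
    refine ContinuousOn.mul (fun τ hτ => ?_) (Continuous.continuousOn ?_)
    · exact (continuousAt_ofReal_cpow_of_pos (hε.trans_le hτ.1) _).continuousWithinAt
    · simpa only [Function.comp_def, Complex.ofReal_sub] using
        (Complex.continuous_ofReal_cpow_const hv).comp (continuous_sub_left x)
  have hftc := intervalIntegral.integral_eq_sub_of_hasDerivAt_of_le hεx hcont
    (fun τ hτ => hasDerivAt_cpow_mul_sub_cpow u v (hε.trans hτ.1) hτ.2) (hint1.sub hint2)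
  rw [intervalIntegral.integral_sub hint1 hint2, intervalIntegral.integral_const_mul,
    intervalIntegral.integral_const_mul, sub_self, Complex.zero_cpow hv0, mul_zero, zero_sub]
    at hftc
  simp only [cutBeta, add_sub_cancel_right]
  linear_combination hftc

theorem cutBeta_recurrence (hu : u ≠ 0) (hv : 0 < v.re) (hε : 0 < ε) (hεx : ε ≤ x) :
    cutBeta x u v ε = (1 + v / u) * (x : ℂ)⁻¹ * cutBeta x (u + 1) v ε +
      -((x : ℂ)⁻¹ * u⁻¹) * ((ε : ℂ) ^ u * ((x : ℂ) - ε) ^ v) := by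
  have hx : (x : ℂ) ≠ 0 := by exact_mod_cast (hε.trans_le hεx).ne'
  have hsplit := mul_cutBeta (u := u) hv hε hεx
  have hparts := mul_cutBeta_add_one (u := u) hv hε hεx
  field_simp
  linear_combination u * hsplit + hparts

theorem hasFinitePart_cutBeta (hu : ∀ k : ℕ, u ≠ -k) (hv : 0 < v.re) (hx : 0 < x) :
    HasFinitePart (cutBeta x u v)
      (Complex.Gamma u * Complex.Gamma v / Complex.Gamma (u + v) * (x : ℂ) ^ (u + v - 1)) := by
  obtain ⟨j, hj⟩ := exists_nat_gt (-u.re)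
  induction j generalizing u with
  | zero =>
    have hu_re : 0 < u.re := by simpa using hj
    rw [← cutBeta_zero hu_re hv hx]
    exact .of_tendsto (tendsto_cutBeta_zero hu_re hv hx)
  | succ j ih =>
    have hu0 : u ≠ 0 := by simpa using hu 0
    have hx0 : (x : ℂ) ≠ 0 := by exact_mod_cast hx.ne'
    have hu1 (k : ℕ) : u + 1 ≠ -k := fun hk => hu (k + 1) (by push_cast; linear_combination hk)
    have hanalytic : AnalyticAt ℂ (fun z : ℂ => ((x : ℂ) - z) ^ v) 0 :=
      (analyticAt_const.sub analyticAt_id).cpow analyticAt_const (by simpa using hx)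
    have hshift := ih hu1 (by push_cast at hj; simp; linarith)
    have hsum := ((hshift.const_mul ((1 + v / u) * (x : ℂ)⁻¹)).add
      ((hasFinitePart_cpow_mul hu hanalytic).const_mul (-((x : ℂ)⁻¹ * u⁻¹)))).congr (by
        filter_upwards [Ioo_mem_nhdsGT hx] with ε hε
        exact (cutBeta_recurrence hu0 hv hε.1 hε.2.le).symm)
    convert hsum using 1
    have hΓ := Complex.one_div_Gamma_eq_self_mul_one_div_Gamma_add_one (u + v)
    have hpow : (x : ℂ) ^ (u + 1 + v - 1) = (x : ℂ) ^ (u + v - 1) * x := by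
      rw [← cpow_add_one hx0]
      ring_nf
    rw [hpow, Complex.Gamma_add_one _ hu0, div_eq_mul_inv _ (Complex.Gamma (u + v)), hΓ,
      add_right_comm u 1 v]
    field_simp
    ring

end CutBeta

/-- The function `e ^ (-σ x) x ^ (γ - 1) / Γ(γ)`, normalised so that `I_s^α` shifts `γ` by `α`. -/
noncomputable def substantialPow (σ γ : ℂ) (x : ℝ) : ℂ :=
  Complex.exp (-σ * x) * ((x : ℂ) ^ (γ - 1) / Complex.Gamma γ)

theorem hasDerivAt_substantialPow (σ γ : ℂ) {x : ℝ} (hx : 0 < x) :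
    HasDerivAt (substantialPow σ γ)
      (substantialPow σ (γ - 1) x - σ * substantialPow σ γ x) x := by
  have hexp : HasDerivAt (fun z : ℂ => Complex.exp (-σ * z)) (Complex.exp (-σ * x) * (-σ * 1)) x :=
    ((hasDerivAt_id (x : ℂ)).const_mul (-σ)).cexp
  have hpow : HasDerivAt (fun z : ℂ => z ^ (γ - 1)) ((γ - 1) * (x : ℂ) ^ (γ - 1 - 1) * 1) x :=
    (hasDerivAt_id (x : ℂ)).cpow_const (Complex.ofReal_mem_slitPlane.2 hx)
  have hΓ := Complex.one_div_Gamma_eq_self_mul_one_div_Gamma_add_one (γ - 1)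
  rw [sub_add_cancel] at hΓ
  refine (hexp.mul (hpow.div_const (Complex.Gamma γ))).comp_ofReal.congr_deriv ?_
  rw [substantialPow, substantialPow, div_eq_mul_inv _ (Complex.Gamma (γ - 1)), hΓ]
  ring

theorem substantialD_iterate_eqOn {σ b γ : ℂ} {g : ℝ → ℂ}
    (hg : Set.EqOn g (fun x => b * substantialPow σ γ x) (Set.Ioi 0)) (k : ℕ) :
    Set.EqOn ((substantialD σ)^[k] g) (fun x => b * substantialPow σ (γ - k) x) (Set.Ioi 0) := by
  induction k with
  | zero => simpa using hg
  | succ k ih =>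
    intro x hx
    have hderiv := ((hasDerivAt_substantialPow σ (γ - k) hx).const_mul b).congr_of_eventuallyEq
      (ih.eventuallyEq_of_mem (Ioi_mem_nhds hx))
    rw [Function.iterate_succ_apply', substantialD, hderiv.deriv, ih hx]
    push_cast
    rw [← sub_sub]
    ring

theorem substantialIntegral_exp_mul_cpow (σ : ℂ) {ν : ℝ} (hν : 0 < ν) {β : ℂ}
    (hβ : ∀ k : ℕ, β ≠ -k) {x : ℝ} (hx : 0 < x) :
    substantialIntegral σ ν (fun t : ℝ => Complex.exp (-σ * t) * (t : ℂ) ^ (β - 1)) x =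
      Complex.Gamma β * substantialPow σ (ν + β) x := by
  have hν0 : 0 < (ν : ℂ).re := by simpa using hν
  have hcut := ((hasFinitePart_cutBeta hβ hν0 hx).const_mul (Complex.exp (-σ * x))).congr
    (G := fun ε => ∫ τ in ε..x, (((x - τ) ^ (ν - 1) : ℝ) : ℂ) *
      Complex.exp (-σ * ((x - τ : ℝ) : ℂ)) * (Complex.exp (-σ * τ) * (τ : ℂ) ^ (β - 1))) ?_
  · rw [substantialIntegral, hcut.finitePart_eq, ← Complex.Gamma_ofReal, substantialPow,
      add_comm (ν : ℂ)]
    have hΓ : Complex.Gamma ν ≠ 0 := Complex.Gamma_ne_zero_of_re_pos hν0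
    field_simp
  · filter_upwards [Ioo_mem_nhdsGT hx] with ε hε
    rw [cutBeta, ← intervalIntegral.integral_const_mul]
    refine intervalIntegral.integral_congr fun τ hτ => ?_
    rw [Set.uIcc_of_le hε.2.le] at hτ
    have hexp : Complex.exp (-σ * x) =
        Complex.exp (-σ * ((x - τ : ℝ) : ℂ)) * Complex.exp (-σ * τ) := by
      rw [← Complex.exp_add, ← mul_add, Complex.ofReal_sub, sub_add_cancel]
    simp only [hexp, Complex.ofReal_cpow (sub_nonneg.2 hτ.2)]
    push_cast
    ring

theorem substantialI_exp_mul_cpow (σ : ℂ) (α : ℝ) {β : ℂ} (hβ : ∀ k : ℕ, β ≠ -k) {x : ℝ}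
    (hx : 0 < x) :
    substantialI σ α (fun t : ℝ => Complex.exp (-σ * t) * (t : ℂ) ^ (β - 1)) x =
      Complex.Gamma β * substantialPow σ (α + β) x := by
  rw [substantialI]
  split_ifs with hα
  · exact substantialIntegral_exp_mul_cpow σ hα hβ hx
  · have hν : 0 < ((⌊-α⌋₊ + 1 : ℕ) : ℝ) - -α := by
      push_cast
      linarith [Nat.lt_floor_add_one (-α)]
    rw [substantialDerivative, substantialD_iterate_eqOn
      (fun x hx => substantialIntegral_exp_mul_cpow σ hν hβ hx) _ hx]
    push_cast
    ring_nf

/-! ### Convergence -/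

theorem natCast_mul_ofReal_cpow (n : ℕ) {h : ℝ} (hh : 0 ≤ h) (z : ℂ) :
    ((n * h : ℝ) : ℂ) ^ z = (n : ℂ) ^ z * (h : ℂ) ^ z := by
  rw [Complex.ofReal_mul, Complex.mul_cpow_ofReal_nonneg n.cast_nonneg hh, Complex.ofReal_natCast]

section QuadratureError

variable (σ : ℂ) (α : ℝ) (ω : ℕ → ℂ) {β : ℂ} {h : ℝ} {n : ℕ}

theorem weightedCQ_mul_exp (hnh : n * h = 1) {i j : ℕ} (hij : i + j = n) :
    weightedCQ σ ω h i * Complex.exp (-σ * ((j * h : ℝ) : ℂ)) = Complex.exp (-σ) * ω i := by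
  have hexponent : -(i : ℂ) * σ * h + -σ * ((j * h : ℝ) : ℂ) = -σ := by
    rw [← hij] at hnh
    have hnhC : ((i : ℂ) + j) * h = 1 := by exact_mod_cast hnh
    push_cast
    linear_combination -σ * hnhC
  rw [weightedCQ, mul_right_comm, ← Complex.exp_add, hexponent]

theorem convQuad_exp_mul_cpow (hβ : ∀ k : ℕ, β ≠ -k) (hh : 0 < h) (hnh : n * h = 1) :
    convQuad α (weightedCQ σ ω) h n (fun t => Complex.exp (-σ * t) * (t : ℂ) ^ (β - 1)) =
      Complex.exp (-σ) * Complex.Gamma β * (h : ℂ) ^ (α + β - 1) *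
        coeff n (.mk ω * powSeries β) := by
  have hΓ : Complex.Gamma β ≠ 0 := Complex.Gamma_ne_zero hβ
  have hh0 : (h : ℂ) ≠ 0 := by exact_mod_cast hh.ne'
  rw [convQuad, mul_comm (PowerSeries.mk ω), coeff_mul,
    Finset.Nat.sum_antidiagonal_eq_sum_range_succ_mk, Finset.mul_sum, Finset.mul_sum]
  refine Finset.sum_congr rfl fun j hj => ?_
  have hij : n - j + j = n := Nat.sub_add_cancel (Finset.mem_range_succ_iff.1 hj)
  rw [← mul_assoc (weightedCQ σ ω h (n - j)), weightedCQ_mul_exp σ ω hnh hij,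
    natCast_mul_ofReal_cpow j hh.le, powSeries, coeff_mk, coeff_mk, add_sub_assoc,
    Complex.cpow_add _ _ hh0, Complex.ofReal_cpow hh.le]
  field_simp

theorem convQuadError_exp_mul_cpow (hβ : ∀ k : ℕ, β ≠ -k) (hh : 0 < h) (hnh : n * h = 1) :
    convQuadError σ α (weightedCQ σ ω) h n (fun t => Complex.exp (-σ * t) * (t : ℂ) ^ (β - 1)) =
      Complex.exp (-σ) * Complex.Gamma β * (h : ℂ) ^ (α + β - 1) *
        coeff n (.mk ω * powSeries β - powSeries (α + β)) := by
  have hpow : (1 : ℂ) ^ (α + β - 1) = (n : ℂ) ^ (α + β - 1) * (h : ℂ) ^ (α + β - 1) := by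
    rw [← natCast_mul_ofReal_cpow n hh.le, hnh, Complex.ofReal_one]
  rw [convQuadError, convQuad_exp_mul_cpow σ α ω hβ hh hnh, hnh,
    substantialI_exp_mul_cpow σ α hβ one_pos, substantialPow, Complex.ofReal_one, mul_one, hpow,
    map_sub]
  simp only [powSeries, coeff_mk]
  ring

theorem norm_convQuadError_exp_mul_cpow (hβ : ∀ k : ℕ, β ≠ -k) (hh : 0 < h) (hnh : n * h = 1) :
    ‖convQuadError σ α (weightedCQ σ ω) h n
      (fun t => Complex.exp (-σ * t) * (t : ℂ) ^ (β - 1))‖ =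
      ‖Complex.exp (-σ) * Complex.Gamma β‖ * h ^ (α + β.re - 1) *
        ‖coeff n (.mk ω * powSeries β - powSeries (α + β))‖ := by
  rw [convQuadError_exp_mul_cpow σ α ω hβ hh hnh, norm_mul, norm_mul,
    Complex.norm_cpow_eq_rpow_re_of_pos hh]
  simp

end QuadratureError

theorem rpow_mul_natCast_rpow_add {α b h : ℝ} {n : ℕ} (p : ℕ) (hh : 0 < h) (hnh : n * h = 1) :
    h ^ (α + b - 1) * ((n : ℝ) ^ (α - 1) + (n : ℝ) ^ (α + b - 1 - p)) = h ^ b + h ^ p := by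
  rw [eq_inv_of_mul_eq_one_left hnh, Real.inv_rpow hh.le, Real.inv_rpow hh.le,
    ← Real.rpow_neg hh.le, ← Real.rpow_neg hh.le, mul_add, ← Real.rpow_add hh, ← Real.rpow_add hh,
    ← Real.rpow_natCast]
  ring_nf

section Convergence

variable {σ : ℂ} {α : ℝ} {p : ℕ} {ω : ℕ → ℂ}

theorem cqConvergent_iff :
    CQConvergent σ α p (weightedCQ σ ω) ↔ ∀ β : ℂ, (∀ k : ℕ, β ≠ -k) →
      HasCoeffBound (.mk ω * powSeries β - powSeries (α + β))
        (max (α - 1) (α + β.re - 1 - p)) := by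
  refine forall₂_congr fun β hβ => ?_
  have hE : 0 < ‖Complex.exp (-σ) * Complex.Gamma β‖ :=
    norm_pos_iff.2 (mul_ne_zero (Complex.exp_ne_zero _) (Complex.Gamma_ne_zero hβ))
  set E := ‖Complex.exp (-σ) * Complex.Gamma β‖ with hE_def
  have error_le_iff {D h : ℝ} {n : ℕ} (hh : 0 < h) (hnh : n * h = 1) :
      ‖convQuadError σ α (weightedCQ σ ω) h n
        (fun t => Complex.exp (-σ * t) * (t : ℂ) ^ (β - 1))‖ ≤ E * D * (h ^ β.re + h ^ p) ↔
      ‖coeff n (.mk ω * powSeries β - powSeries (α + β))‖ ≤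
        D * ((n : ℝ) ^ (α - 1) + (n : ℝ) ^ (α + β.re - 1 - p)) := by
    rw [norm_convQuadError_exp_mul_cpow σ α ω hβ hh hnh, ← hE_def,
      ← rpow_mul_natCast_rpow_add (α := α) p hh hnh, mul_mul_mul_comm]
    exact mul_le_mul_iff_right₀ (by positivity)
  rw [HasCoeffBound.max_iff]
  constructor
  · rintro ⟨D, hD⟩
    refine ⟨E⁻¹ * D, fun n hn => ?_⟩
    have hn0 : (0 : ℝ) < n := by exact_mod_cast hn
    have hnh : (n : ℝ) * (n : ℝ)⁻¹ = 1 := mul_inv_cancel₀ hn0.ne'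
    rw [← error_le_iff (inv_pos.2 hn0) hnh, mul_inv_cancel_left₀ hE.ne']
    exact hD _ n (inv_pos.2 hn0) hnh
  · rintro ⟨D, hD⟩
    refine ⟨E * D, fun h n hh hnh => (error_le_iff hh hnh).2 (hD n ?_)⟩
    rw [Nat.one_le_iff_ne_zero]
    rintro rfl
    simp at hnh

end Convergence

theorem powSeries_one_mul_one_sub_X : powSeries 1 * (1 - X) = 1 := by
  convert mk_one_mul_one_sub_eq_one ℂ
  ext n
  simp [powSeries]

theorem hasCoeffBound_powSeries_sub_oneSubCPow (γ : ℂ) :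
    HasCoeffBound (powSeries γ - oneSubCPow γ) (γ.re - 2) := by
  convert hasCoeffBound_powSeries_sub_expandAtOne γ 1 using 1
  · simp [expandAtOne, coeff_zero_negLogSeries]
  · rw [Nat.cast_one]
    ring

section Equivalence

variable {α : ℝ} {W S : ℂ⟦X⟧} {p : ℕ}

-- Multiplying by `1 - X` recovers `W` from its product with the geometric series `powSeries 1`.
theorem hasCoeffBound_of_mul_powSeries_one_sub
    (h : HasCoeffBound (W * powSeries 1 - powSeries (α + 1)) (α - 1)) :
    HasCoeffBound W (α - 1) := by
  have hpow : HasCoeffBound (powSeries (α + 1) - oneSubCPow (α + 1)) (α - 1) := by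
    convert hasCoeffBound_powSeries_sub_oneSubCPow (α + 1) using 1
    simp
    ring
  have hα : oneSubCPow (α + 1) * (1 - X) ^ 1 = oneSubCPow (α : ℂ) := by
    rw [← oneSubCPow_sub_natCast, Nat.cast_one, add_sub_cancel_right]
  have hsplit : W = (W * powSeries 1 - powSeries (α + 1) +
      (powSeries (α + 1) - oneSubCPow (α + 1))) * (1 - X) ^ 1 + oneSubCPow (α : ℂ) := by
    rw [← hα]
    linear_combination -W * powSeries_one_mul_one_sub_X
  rw [hsplit]
  exact ((h.add hpow).mul_one_sub_X_pow 1).add (hasCoeffBound_oneSubCPow α)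

theorem hasCoeffBound_mul_powSeries_sub_powSeries_iff {β : ℂ} {c : ℝ} (hS : HasCoeffBound
    (W * powSeries β - expandAtOne (α + β) (S * negLogSeries β) p) c)
    (hc : α + β.re - 1 - p ≤ c) :
    HasCoeffBound (W * powSeries β - powSeries (α + β)) c ↔
      HasCoeffBound (expandAtOne (α + β) ((S - negLogSeries α) * negLogSeries β) p) c := by
  have hpow : HasCoeffBound (powSeries (α + β) -
      expandAtOne (α + β) (negLogSeries α * negLogSeries β) p) c := by
    rw [← negLogSeries_add]
    exact (hasCoeffBound_powSeries_sub_expandAtOne (α + β) p).mono (by simpa using hc)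
  rw [sub_mul, expandAtOne_sub]
  constructor <;> intro h
  · convert (h.sub hS).add hpow using 1
    ring
  · convert (h.add hS).sub hpow using 1
    ring

theorem ne_neg_natCast_of_re_pos {β : ℂ} (hβ : 0 < β.re) (k : ℕ) : β ≠ -k := by
  rintro rfl
  exact hβ.not_ge (by simp)

theorem forall_hasCoeffBound_iff_X_pow_dvd (hS : ∀ β : ℂ, HasCoeffBound
    (W * powSeries β - expandAtOne (α + β) (S * negLogSeries β) p)
      (max (α - 1) (α + β.re - 1 - p))) :
    (∀ β : ℂ, (∀ k : ℕ, β ≠ -k) → HasCoeffBound (W * powSeries β - powSeries (α + β))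
      (max (α - 1) (α + β.re - 1 - p))) ↔ X ^ p ∣ S - negLogSeries α := by
  simp only [hasCoeffBound_mul_powSeries_sub_powSeries_iff (hS _) (le_max_right _ _)]
  constructor
  · intro h
    obtain ⟨β, hβ, hpα, hpβ⟩ : ∃ β : ℝ, 0 < β ∧ p < α + β ∧ p ≤ β :=
      ⟨p + |α| + 1, by positivity, by linarith [neg_abs_le α], by linarith [abs_nonneg α]⟩
    have hbound := h β (ne_neg_natCast_of_re_pos hβ)
    rw [max_eq_right (by rw [Complex.ofReal_re]; linarith)] at hbound
    have hdvd := X_pow_dvd_of_hasCoeffBound_expandAtOne (by simpa using hpα) hbound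
    have hinv : negLogSeries β * negLogSeries (-β) = 1 := by
      rw [← negLogSeries_add, add_neg_cancel, negLogSeries_zero]
    simpa only [mul_assoc, hinv, mul_one] using hdvd.mul_right (negLogSeries (-β))
  · intro h β _
    rw [expandAtOne_eq_zero (h.mul_right _)]
    exact .of_eventually_eq_zero (by simp) _

end Equivalence

theorem theorem4p12 (σ : ℂ) (α : ℝ) (p : ℕ) (hp : 1 ≤ p) (ω : ℕ → ℂ) (hω : CQRegular α ω) :
    (CQStable α (weightedCQ σ ω) ∧ CQConsistent σ α p (weightedCQ σ ω)) ↔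
      CQConvergent σ α p (weightedCQ σ ω) := by
  obtain ⟨g, hg, hsum⟩ := hω
  replace hsum : HasSumNearOne (.mk ω) fun ζ => (1 - ζ) ^ (-(α : ℂ)) * g ζ := by
    simpa only [HasSumNearOne, coeff_mk] using hsum
  have convergent_iff (hstable : HasCoeffBound (.mk ω) (α - 1)) :=
    forall_hasCoeffBound_iff_X_pow_dvd fun β =>
      hasCoeffBound_mul_powSeries_sub_expandAtOne hstable hg hsum β p
  rw [cqStable_iff, cqConsistent_iff hg hsum, cqConvergent_iff]
  constructor
  · rintro ⟨hstable, hconsistent⟩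
    exact (convergent_iff hstable).2 hconsistent
  · intro hconvergent
    have hp' : (1 : ℝ) ≤ p := by exact_mod_cast hp
    have hone := hconvergent 1 (ne_neg_natCast_of_re_pos (by simp))
    have hstable := hasCoeffBound_of_mul_powSeries_one_sub (hone.mono (by simp; linarith))
    exact ⟨hstable, (convergent_iff hstable).1 hconvergent⟩
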